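/- Let $p$ be an odd prime, let $\mathbb Q_p^{\rm ur}\subset\mathbb Q_p^{\rm alg}$ be the maximal unramified extension of $\mathbb Q_p$, let $K\subset\mathbb C_p$ be its metric completion and $R$ the valuation ring of $K$. Let $\pi\in\mathbb Q_p^{\rm alg}$ be a prime element of some finite Galois extension of $\mathbb Q_p$, and put $R_\pi=R[\pi]$. Let $\widehat{\ }$ denote $p$-adic completion and let $s\ge 1$ be an integer. For an $R_\pi$-algebra $A$ without $\pi$-torsion, a higher $\pi$-derivation of degree $s$ on $A$ is a map $\delta:A\to A$ of the form $\delta(a)=(\phi(a)-a^{p^s})/\pi$, where $\phi$ is a ring endomorphism of $A$ reducing to the $p^s$-power map modulo $\pi$ (the higher $\pi$-Frobenius lift associated to $\delta$). Fix higher $\pi$-derivations $\delta_1,\dots,\delta_n$ of degree $s$ on $R_\pi$, with associated lifts $\phi_1,\dots,\phi_n$. Let $x=(x_{ij})$ be an $n\times n$ matrix of indeterminates and $\mathcal A=R_\pi[x,\det(x)^{-1}]^{\widehat{\ }}$. Let $\mathcal P=(x-1)$ be the ideal of $\mathcal A$ generated by the entries of $x-1$, and $\mathcal M=(\pi,\mathcal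 P)$. For a matrix $a$ write $a^{(p^s)}=(a_{ij}^{p^s})$. A $\pi$-connection of degree $s$ on $GL_n$ is an $n$-tuple $(\delta_1^G,\dots,\delta_n^G)$ of higher $\pi$-derivations of degree $s$ on $\mathcal A$ extending $\delta_1,\dots,\delta_n$ respectively; write $\phi_i^G$ for the associated lifts, and put $$\Lambda_i=(x^{(p^s)})^{-1}\phi_i^G(x),\qquad \Gamma_i^{t}=(x^{(p^s)})^{-1}\delta_i^G(x),\qquad \Gamma_{ij}^k=(\Gamma_i)_{jk}.$$ Let $q\in GL_n(R_\pi)$ be a symmetric matrix (a metric). The $\pi$-connection is metric with respect to $q$ if $\mathcal H_q\circ\phi_{i,0}^G=\phi_i^G\circ\mathcal H_q$ for all $i$, where $\mathcal H_q:\mathcal A\to\mathcal A$ is the $R_\pi$-algebra map with $\mathcal H_q(x)=x^tqx$ and $\phi_{i,0}^G:\mathcal A\to\mathcal A$ is the ring homomorphism extending $\phi_i$ with $\phi_{i,0}^G(x)=x^{(p^s)}$. Let $L=(L^1,\dots,L^n)$ be a torsion symbol, i.e. an $n$-tuple of $n\times n$ antisymmetric matrices $L^k=(L^k_{ij})$,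 $L^k_{ij}+L^k_{ji}=0$, with entries in $\widehat{R_\pi[y]}$, where $y=(y_1,\dots,y_n)$ is an $n$-tuple of $n\times n$ matrices of indeterminates. The $\pi$-connection is symmetric with respect to $L$ if $\Gamma^k_{ij}-\Gamma^k_{ji}=L^k_{ij}(\Lambda_1,\dots,\Lambda_n)$ for all $i,j,k$. Set $L_{ijk}=\sum_m L^m_{ij}q_{mk}^{p^s}$ and $\Gamma_{ijk}=\sum_m\Gamma^m_{ij}q_{mk}^{p^s}$ (symbols of the first kind), and write $F(1)$ for the value of $F\in\widehat{R_\pi[y]}$ at $y_1=\dots=y_n=1$. Then: 1) There exists a unique $\pi$-connection of degree $s$ on $GL_n$ that is metric with respect to $q$ and symmetric with respect to $L$. 2) Its Christoffel symbols of the first kind satisfy, for all $i,j,k$, $$\Gamma_{ijk}\equiv-\tfrac12(\delta_iq_{jk}+\delta_jq_{ik}-\delta_kq_{ij})+\tfrac12(L_{kij}(1)+L_{ijk}(1)-L_{jki}(1))\pmod{\mathcal M}.$$ 3) If $m\ge1$ is an integer such that $L^k_{ij}(1)\equiv\delta_iq_{jk}\equiv0\pmod{\pi^m}$ in $R_\pi$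 for all $i,j,k$, then $\Gamma_{ijk}\equiv0\pmod{(\pi^m,\mathcal P)}$ in $\mathcal A$ for all $i,j,k$. -/

import Mathlib

noncomputable section
namespace LeviCivita

/-! ### The ground ring -/

/-- The maximal unramified extension of `ℚ_p` inside the algebraic closure: the compositum of the
finite extensions `F / ℚ_p` of ramification index `1`, i.e. with the same value group as `ℚ_p`
(residue fields are finite, so residue field extensions are automatically separable). -/
def QpUr (p : ℕ) [Fact p.Prime] : IntermediateField ℚ_[p] (PadicAlgCl p) :=
  ⨆ F ∈ {F : IntermediateField ℚ_[p] (PadicAlgCl p) |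
    FiniteDimensional ℚ_[p] F ∧ ∀ x ∈ F, ∃ y : ℚ_[p], ‖x‖ = ‖y‖}, F

/-- The field `K`: the metric completion of `QpUr p`, realised as its closure in `ℂ_p`. -/
def KHat (p : ℕ) [Fact p.Prime] : Subfield ℂ_[p] :=
  ((QpUr p).toSubfield.map (algebraMap (PadicAlgCl p) ℂ_[p])).topologicalClosure

/-- The valuation ring `R` of `K`. -/
def RHat (p : ℕ) [Fact p.Prime] : Subring ℂ_[p] where
  carrier := {x | x ∈ KHat p ∧ ‖x‖ ≤ 1}
  mul_mem' {a b} ha hb := ⟨mul_mem ha.1 hb.1, by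
    rw [norm_mul]; exact mul_le_one₀ ha.2 (norm_nonneg _) hb.2⟩
  one_mem' := ⟨one_mem _, by simp⟩
  add_mem' {a b} ha hb := ⟨add_mem ha.1 hb.1,
    (IsUltrametricDist.norm_add_le_max a b).trans (max_le ha.2 hb.2)⟩
  zero_mem' := ⟨zero_mem _, by simp⟩
  neg_mem' {a} ha := ⟨neg_mem ha.1, by rw [norm_neg]; exact ha.2⟩

/-- The set `Π` of all `π` in the algebraic closure of `ℚ_p` that are a prime element of some
finite Galois extension `E / ℚ_p`, i.e. generate the maximal ideal of the valuation ring of `E`. -/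
def PrimeElements (p : ℕ) [Fact p.Prime] : Set (PadicAlgCl p) :=
  {π | ∃ E : IntermediateField ℚ_[p] (PadicAlgCl p),
    FiniteDimensional ℚ_[p] E ∧ IsGalois ℚ_[p] E ∧
      π ∈ E ∧ π ≠ 0 ∧ ‖π‖ < 1 ∧ ∀ y ∈ E, ‖y‖ < 1 → ‖y‖ ≤ ‖π‖}

/-- The ring `R_π = R[π]`, a subring of `ℂ_p`. -/
abbrev RPi (p : ℕ) [Fact p.Prime] (π : PrimeElements p) : Type :=
  Algebra.adjoin (RHat p) {((π : PadicAlgCl p) : ℂ_[p])}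

/-- The element `π` of `R_π`. -/
def RPi.unif (p : ℕ) [Fact p.Prime] (π : PrimeElements p) : RPi p π :=
  ⟨((π : PadicAlgCl p) : ℂ_[p]), Algebra.subset_adjoin rfl⟩

theorem norm_natCast_prime (p : ℕ) [Fact p.Prime] : ‖(p : ℂ_[p])‖ = (p : ℝ)⁻¹ := by
  have h := PadicComplex.norm_extends' p (p : ℚ_[p])
  rw [Padic.norm_p] at h
  rw [← h, map_natCast, PadicComplex.coe_natCast]

theorem mem_RHat_of_padicInt (p : ℕ) [Fact p.Prime] (a : ℤ_[p]) :
    ((algebraMap ℚ_[p] (PadicAlgCl p) a : PadicAlgCl p) : ℂ_[p]) ∈ RHat p := by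
  refine ⟨Subfield.le_topologicalClosure _ ⟨_, (QpUr p).algebraMap_mem _, rfl⟩, ?_⟩
  rw [PadicComplex.norm_extends, PadicAlgCl.norm_extends]
  exact PadicInt.norm_le_one a

theorem isIntegral_unif (p : ℕ) [Fact p.Prime] (π : PrimeElements p) :
    IsIntegral (RHat p) ((π : PadicAlgCl p) : ℂ_[p]) := by
  obtain ⟨E, -, -, -, -, hlt, -⟩ := π.2
  have hint : IsIntegral ℚ_[p] (π : PadicAlgCl p) := Algebra.IsIntegral.isIntegral _
  have hm := minpoly.monic hint
  have hco : ∀ k, ‖(minpoly ℚ_[p] (π : PadicAlgCl p)).coeff k‖ ≤ 1 := by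
    have h1 : spectralValue (minpoly ℚ_[p] (π : PadicAlgCl p)) ≤ 1 := hlt.le
    exact (spectralValue_le_one_iff hm).1 h1
  let g : Polynomial ℂ_[p] := ((minpoly ℚ_[p] (π : PadicAlgCl p)).map
    (algebraMap ℚ_[p] (PadicAlgCl p))).map (algebraMap (PadicAlgCl p) ℂ_[p])
  have hg : g.Monic := (hm.map _).map _
  have hl : g ∈ Polynomial.lifts (algebraMap (RHat p) ℂ_[p]) := by
    rw [Polynomial.lifts_iff_coeff_lifts]
    intro k
    refine ⟨⟨_, mem_RHat_of_padicInt p ⟨_, hco k⟩⟩, ?_⟩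
    simp only [g, Polynomial.coeff_map]
    rfl
  obtain ⟨h, hh, -, hhm⟩ := Polynomial.lifts_and_natDegree_eq_and_monic hl hg
  refine ⟨h, hhm, ?_⟩
  rw [← Polynomial.eval_map, hh]
  simp only [g]
  rw [PadicComplex.coe_eq, Polynomial.eval_map, Polynomial.eval₂_at_apply, Polynomial.eval_map,
    ← Polynomial.aeval_def, minpoly.aeval, map_zero]

theorem RPi.norm_le_one (p : ℕ) [Fact p.Prime] (π : PrimeElements p) (x : RPi p π) :
    ‖(x : ℂ_[p])‖ ≤ 1 := by
  obtain ⟨x, hx⟩ := x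
  obtain ⟨E, -, -, -, -, hlt, -⟩ := π.2
  induction hx using Algebra.adjoin_induction with
  | mem x hx =>
    rw [Set.mem_singleton_iff] at hx
    subst hx
    simpa using hlt.le
  | algebraMap r => exact r.2.2
  | add a b _ _ ha hb => exact (IsUltrametricDist.norm_add_le_max a b).trans (max_le ha hb)
  | mul a b _ _ ha hb =>
    simp only [norm_mul]; exact mul_le_one₀ ha (norm_nonneg _) hb

theorem RHat.isPrecomplete (p : ℕ) [Fact p.Prime] :
    IsPrecomplete (Ideal.span {(p : RHat p)}) (RHat p) := by
  refine ⟨fun f hf => ?_⟩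
  have hp0 : (p : ℂ_[p]) ≠ 0 := by exact_mod_cast (Fact.out : p.Prime).ne_zero
  have hp1 : (1 : ℝ) < p := by exact_mod_cast (Fact.out : p.Prime).one_lt
  have hdiff : ∀ {m n}, m ≤ n → ‖(f m : ℂ_[p]) - f n‖ ≤ ((p : ℝ)⁻¹) ^ m := by
    intro m n hmn
    have h := hf hmn
    rw [SModEq.sub_mem, smul_eq_mul, Ideal.mul_top, Ideal.span_singleton_pow,
      Ideal.mem_span_singleton'] at h
    obtain ⟨a, ha⟩ := h
    have h2 : (f m : ℂ_[p]) - f n = a * (p : ℂ_[p]) ^ m := by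
      have := congrArg (Subtype.val) ha
      push_cast at this
      exact this.symm
    rw [h2, norm_mul, norm_pow, norm_natCast_prime]
    exact mul_le_of_le_one_left (by positivity) a.2.2
  have hcau : CauchySeq (fun n => (f n : ℂ_[p])) := by
    refine cauchySeq_of_le_tendsto_0' (fun n => ((p : ℝ)⁻¹) ^ n) (fun m n hmn => ?_) ?_
    · rw [dist_eq_norm]; exact hdiff hmn
    · exact tendsto_pow_atTop_nhds_zero_of_lt_one (by positivity) (inv_lt_one_of_one_lt₀ hp1)
  obtain ⟨l, hl⟩ := cauchySeq_tendsto_of_complete hcau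
  have hK : IsClosed (KHat p : Set ℂ_[p]) := Subfield.isClosed_topologicalClosure _
  have hlK : l ∈ KHat p := hK.mem_of_tendsto hl (Filter.Eventually.of_forall fun n => (f n).2.1)
  have hl1 : ‖l‖ ≤ 1 := le_of_tendsto hl.norm (Filter.Eventually.of_forall fun n => (f n).2.2)
  refine ⟨⟨l, hlK, hl1⟩, fun n => ?_⟩
  rw [SModEq.sub_mem, smul_eq_mul, Ideal.mul_top, Ideal.span_singleton_pow,
    Ideal.mem_span_singleton']
  have hn : ‖(f n : ℂ_[p]) - l‖ ≤ ((p : ℝ)⁻¹) ^ n :=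
    le_of_tendsto (hl.const_sub _).norm (Filter.eventually_atTop.2 ⟨n, fun k hk => hdiff hk⟩)
  refine ⟨⟨((f n : ℂ_[p]) - l) / (p : ℂ_[p]) ^ n, ?_, ?_⟩, ?_⟩
  · exact div_mem (sub_mem (f n).2.1 hlK) (pow_mem (natCast_mem _ p) n)
  · rw [norm_div, norm_pow, norm_natCast_prime]
    exact div_le_one_of_le₀ hn (by positivity)
  · apply Subtype.ext
    push_cast
    exact div_mul_cancel₀ _ (pow_ne_zero _ hp0)

theorem isPrecomplete_of_finite {R : Type*} [CommRing R] (a : R) (M : Type*)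
    [AddCommGroup M] [Module R M] [Module.Finite R M] [IsPrecomplete (Ideal.span {a}) R] :
    IsPrecomplete (Ideal.span {a}) M := by
  obtain ⟨d, g, hg⟩ := Module.Finite.exists_fin' R M
  refine ⟨fun f hf => ?_⟩
  have hu : ∀ m, ∃ v, f (m + 1) - f m = a ^ m • g v := by
    intro m
    have h := (hf (Nat.le_succ m)).symm
    rw [SModEq.sub_mem, Ideal.span_singleton_pow, Submodule.ideal_span_singleton_smul] at h
    obtain ⟨u, -, hu⟩ := Submodule.mem_smul_pointwise_iff_exists _ _ _ |>.1 h
    obtain ⟨v, rfl⟩ := hg u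
    exact ⟨v, hu.symm⟩
  choose v hv using hu
  obtain ⟨w, hw⟩ := hg (f 0)
  let F : ℕ → Fin d → R := fun m => w + ∑ k ∈ Finset.range m, a ^ k • v k
  have hF : ∀ m, g (F m) = f m := by
    intro m
    simp only [F, map_add, map_sum, map_smul, hw, ← hv, Finset.sum_range_sub]
    abel
  have hL : ∀ j, ∃ l : R, ∀ n, ∃ c, F n j - l = a ^ n * c := by
    intro j
    obtain ⟨l, hl⟩ := IsPrecomplete.prec (I := Ideal.span {a}) (M := R) inferInstance
      (f := fun n => F n j) (by
        intro m n hmn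
        rw [SModEq.comm, SModEq.sub_mem, smul_eq_mul, Ideal.mul_top, Ideal.span_singleton_pow,
          Ideal.mem_span_singleton]
        simp only [F, Pi.add_apply, Finset.sum_apply, Pi.smul_apply, smul_eq_mul,
          add_sub_add_left_eq_sub, ← Finset.sum_Ico_eq_sub _ hmn]
        exact Finset.dvd_sum fun k hk => Dvd.dvd.mul_right
          (pow_dvd_pow a (Finset.mem_Ico.1 hk).1) _)
    refine ⟨l, fun n => ?_⟩
    have h := hl n
    rwa [SModEq.sub_mem, smul_eq_mul, Ideal.mul_top, Ideal.span_singleton_pow,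
      Ideal.mem_span_singleton] at h
  choose l c hc using hL
  refine ⟨g l, fun n => ?_⟩
  rw [SModEq.sub_mem, Ideal.span_singleton_pow, Submodule.ideal_span_singleton_smul, ← hF,
    ← map_sub, show F n - l = a ^ n • fun j => c j n from funext fun j => hc j n, map_smul]
  exact Submodule.smul_mem_pointwise_smul _ _ _ trivial

/-- `R_π` is `p`-adically complete. -/
instance RPi.isAdicComplete (p : ℕ) [Fact p.Prime] (π : PrimeElements p) :
    IsAdicComplete (Ideal.span {(p : RPi p π)}) (RPi p π) := by
  have hp1 : (1 : ℝ) < p := by exact_mod_cast (Fact.out : p.Prime).one_lt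
  refine { haus' := fun x hx => ?_, prec' := ?_ }
  · have h : ∀ n : ℕ, ‖(x : ℂ_[p])‖ ≤ ((p : ℝ)⁻¹) ^ n := by
      intro n
      have h := hx n
      rw [SModEq.zero, smul_eq_mul, Ideal.mul_top, Ideal.span_singleton_pow,
        Ideal.mem_span_singleton'] at h
      obtain ⟨a, ha⟩ := h
      have h2 : (x : ℂ_[p]) = a * (p : ℂ_[p]) ^ n := by
        have := congrArg (Subtype.val) ha
        push_cast at this
        exact this.symm
      rw [h2, norm_mul, norm_pow, norm_natCast_prime]
      exact mul_le_of_le_one_left (by positivity) (RPi.norm_le_one p π a)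
    have h0 : ‖(x : ℂ_[p])‖ ≤ 0 := ge_of_tendsto'
      (tendsto_pow_atTop_nhds_zero_of_lt_one (by positivity) (inv_lt_one_of_one_lt₀ hp1)) h
    exact Subtype.ext (norm_le_zero_iff.1 h0)
  · have hfin : Module.Finite (RHat p) (RPi p π) :=
      Module.Finite.iff_fg.2 (isIntegral_unif p π).fg_adjoin_singleton
    have hR := RHat.isPrecomplete p
    have hpre := isPrecomplete_of_finite (p : RHat p) (RPi p π)
    have := (IsPrecomplete.map_algebraMap_iff (S := RPi p π)).2 hpre
    rw [Ideal.map_span, Set.image_singleton, map_natCast] at this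
    exact this.prec'

/-! ### `p`-adic completions -/

/-- The `p`-adic completion of a ring `S`. -/
abbrev PComp (p : ℕ) (S : Type*) [CommRing S] : Type _ :=
  AdicCompletion (Ideal.span {(p : S)}) S

instance PComp.isAdicComplete (p : ℕ) (S : Type*) [CommRing S] :
    IsAdicComplete (Ideal.span {(p : PComp p S)}) (PComp p S) := by
  have h := AdicCompletion.isAdicComplete (I := Ideal.span {(p : S)}) (M := S)
    ⟨{(p : S)}, by simp⟩
  rw [← IsAdicComplete.map_algebraMap_iff (S := PComp p S), Ideal.map_span,
    Set.image_singleton, map_natCast] at h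
  exact h

theorem PComp.span_pow_le_comap (p : ℕ) {S T : Type*} [CommRing S] [CommRing T] (f : S →+* T)
    (n : ℕ) : Ideal.span {(p : S)} ^ n ≤ (Ideal.span {(p : T)} ^ n).comap f := by
  rw [← Ideal.map_le_iff_le_comap, Ideal.map_pow, Ideal.map_span, Set.image_singleton,
    map_natCast]

/-- The homomorphism from the `p`-adic completion of `S` to `T / p ^ n` induced by `f : S → T`. -/
def PComp.liftMod (p : ℕ) {S T : Type*} [CommRing S] [CommRing T] (f : S →+* T) (n : ℕ) :
    PComp p S →+* T ⧸ Ideal.span {(p : T)} ^ n :=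
  (Ideal.quotientMap (Ideal.span {(p : T)} ^ n) f (PComp.span_pow_le_comap p f n)).comp
    (AdicCompletion.evalₐ (Ideal.span {(p : S)}) n).toRingHom

theorem PComp.factorPow_comp_liftMod (p : ℕ) {S T : Type*} [CommRing S] [CommRing T]
    (f : S →+* T) {m n : ℕ} (hmn : m ≤ n) :
    (Ideal.Quotient.factorPow (Ideal.span {(p : T)}) hmn).comp (PComp.liftMod p f n) =
      PComp.liftMod p f m := by
  ext x
  obtain ⟨a, rfl⟩ := AdicCompletion.mk_surjective _ _ x
  have h := congrArg (Ideal.quotientMap (Ideal.span {(p : T)} ^ m) f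
    (PComp.span_pow_le_comap p f m))
    (AdicCompletion.Ideal.mk_eq_mk (I := Ideal.span {(p : S)}) hmn a)
  simpa [PComp.liftMod] using h

/-- The extension of a ring homomorphism `f : S → T` to the `p`-adic completion of `S`, when `T` is
`p`-adically complete. -/
def PComp.lift (p : ℕ) {S T : Type*} [CommRing S] [CommRing T]
    [IsAdicComplete (Ideal.span {(p : T)}) T] (f : S →+* T) : PComp p S →+* T :=
  IsAdicComplete.liftRingHom (Ideal.span {(p : T)}) (PComp.liftMod p f)
    (PComp.factorPow_comp_liftMod p f)

theorem PComp.lift_algebraMap (p : ℕ) {S T : Type*} [CommRing S] [CommRing T]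
    [IsAdicComplete (Ideal.span {(p : T)}) T] (f : S →+* T) (a : S) :
    PComp.lift p f (algebraMap S (PComp p S) a) = f a := by
  refine IsHausdorff.eq_iff_smodEq (I := Ideal.span {(p : T)}) |>.2 fun n => ?_
  rw [smul_eq_mul, Ideal.mul_top, SModEq]
  change Ideal.Quotient.mk _ _ = Ideal.Quotient.mk _ _
  rw [PComp.lift, IsAdicComplete.mk_liftRingHom, AdicCompletion.algebraMap_apply]
  simp [PComp.liftMod]

/-! ### The ring `𝒜 = B[x, det(x)⁻¹]^` -/

/-- The coordinate ring `B[x, det(x)⁻¹]` of `GL_N` over `B`. -/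
abbrev GLRing (B : Type*) [CommRing B] (N : ℕ) : Type _ :=
  Localization.Away (Matrix.mvPolynomialX (Fin N) (Fin N) B).det

/-- The ring `𝒜`, the `p`-adic completion of `B[x, det(x)⁻¹]`. -/
abbrev GLHat (p : ℕ) (B : Type*) [CommRing B] (N : ℕ) : Type _ :=
  PComp p (GLRing B N)

/-- The matrix `x` of indeterminates, with entries in `𝒜`. -/
def GLHat.x (p : ℕ) (B : Type*) [CommRing B] (N : ℕ) : Matrix (Fin N) (Fin N) (GLHat p B N) :=
  (Matrix.mvPolynomialX (Fin N) (Fin N) B).map fun f =>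
    algebraMap (GLRing B N) (GLHat p B N) (algebraMap _ (GLRing B N) f)

theorem GLHat.isUnit_det_x (p : ℕ) (B : Type*) [CommRing B] (N : ℕ) :
    IsUnit (GLHat.x p B N).det := by
  have h := (IsLocalization.Away.algebraMap_isUnit (S := GLRing B N)
    (Matrix.mvPolynomialX (Fin N) (Fin N) B).det).map (algebraMap (GLRing B N) (GLHat p B N))
  rwa [RingHom.map_det, RingHom.map_det] at h

theorem isUnit_det_eval₂Hom {B T : Type*} [CommRing B] [CommRing T] {N : ℕ} (f : B →+* T)
    (M : Matrix (Fin N) (Fin N) T) (hM : IsUnit M.det) :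
    IsUnit (MvPolynomial.eval₂Hom f (fun v : Fin N × Fin N => M v.1 v.2)
      (Matrix.mvPolynomialX (Fin N) (Fin N) B).det) := by
  rw [RingHom.map_det]
  convert hM
  ext i j
  simp [Matrix.mvPolynomialX]

/-- The ring homomorphism `𝒜 → T` that is `f` on `B` and sends the matrix `x` to the invertible
matrix `M`, for `T` a `p`-adically complete ring. -/
def GLHat.lift (p : ℕ) {B T : Type*} [CommRing B] [CommRing T]
    [IsAdicComplete (Ideal.span {(p : T)}) T] {N : ℕ} (f : B →+* T)
    (M : Matrix (Fin N) (Fin N) T) (hM : IsUnit M.det) : GLHat p B N →+* T :=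
  PComp.lift p (IsLocalization.Away.lift (S := GLRing B N)
    (Matrix.mvPolynomialX (Fin N) (Fin N) B).det (isUnit_det_eval₂Hom f M hM))

theorem GLHat.lift_algebraMap (p : ℕ) {B T : Type*} [CommRing B] [CommRing T]
    [IsAdicComplete (Ideal.span {(p : T)}) T] {N : ℕ} (f : B →+* T)
    (M : Matrix (Fin N) (Fin N) T) (hM : IsUnit M.det) (b : B) :
    GLHat.lift p f M hM (algebraMap B (GLHat p B N) b) = f b := by
  rw [GLHat.lift, IsScalarTower.algebraMap_apply B (GLRing B N) (GLHat p B N),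
    PComp.lift_algebraMap,
    IsScalarTower.algebraMap_apply B (MvPolynomial (Fin N × Fin N) B) (GLRing B N),
    IsLocalization.Away.lift_eq]
  simp

theorem GLHat.lift_x (p : ℕ) {B T : Type*} [CommRing B] [CommRing T]
    [IsAdicComplete (Ideal.span {(p : T)}) T] {N : ℕ} (f : B →+* T)
    (M : Matrix (Fin N) (Fin N) T) (hM : IsUnit M.det) :
    (GLHat.x p B N).map (GLHat.lift p f M hM) = M := by
  ext i j
  simp only [GLHat.x, GLHat.lift, Matrix.map_apply]
  rw [PComp.lift_algebraMap, IsLocalization.Away.lift_eq]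
  simp [Matrix.mvPolynomialX]

/-- The matrix `x^(p^s)`, whose entries are the `p^s`-th powers of the entries of `x`. -/
def GLHat.xPow (p : ℕ) (B : Type*) [CommRing B] (N s : ℕ) :
    Matrix (Fin N) (Fin N) (GLHat p B N) :=
  (GLHat.x p B N).map (· ^ p ^ s)

theorem isUnit_of_isUnit_mk {p : ℕ} {T : Type*} [CommRing T]
    [IsAdicComplete (Ideal.span {(p : T)}) T] {a : T}
    (h : IsUnit (Ideal.Quotient.mk (Ideal.span {(p : T)}) a)) : IsUnit a := by
  obtain ⟨b, hb⟩ := Ideal.Quotient.mk_surjective (↑h.unit⁻¹ : T ⧸ Ideal.span {(p : T)})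
  have h1 : a * b - 1 ∈ Ideal.span {(p : T)} := by
    rw [← Ideal.Quotient.eq, map_mul, hb, map_one]
    exact h.mul_val_inv
  have h2 := IsAdicComplete.le_jacobson_bot _ h1
  rw [Ideal.mem_jacobson_bot] at h2
  have h3 := h2 1
  rw [mul_one, sub_add_cancel] at h3
  exact isUnit_of_mul_isUnit_left h3

theorem GLHat.isUnit_det_xPow (p : ℕ) [Fact p.Prime] (B : Type*) [CommRing B] (N s : ℕ) :
    IsUnit (GLHat.xPow p B N s).det := by
  apply isUnit_of_isUnit_mk (p := p)
  rcases subsingleton_or_nontrivial (GLHat p B N ⧸ Ideal.span {(p : GLHat p B N)}) with h | h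
  · exact isUnit_of_subsingleton _
  have hc : CharP (GLHat p B N ⧸ Ideal.span {(p : GLHat p B N)}) p := by
    refine (CharP.charP_iff_prime_eq_zero Fact.out).2 ?_
    rw [← map_natCast (Ideal.Quotient.mk (Ideal.span {(p : GLHat p B N)})),
      Ideal.Quotient.eq_zero_iff_mem]
    exact Ideal.mem_span_singleton_self _
  have h1 : Ideal.Quotient.mk (Ideal.span {(p : GLHat p B N)}) (GLHat.xPow p B N s).det =
      Ideal.Quotient.mk (Ideal.span {(p : GLHat p B N)}) ((GLHat.x p B N).det ^ p ^ s) := by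
    rw [map_pow, ← iterateFrobenius_def, RingHom.map_det, RingHom.map_det, RingHom.map_det]
    congr 1
  rw [h1]
  exact ((GLHat.isUnit_det_x p B N).pow _).map _

/-- The ideal `𝒫 = (x - 1)` of `𝒜`. -/
def GLHat.idealP (p : ℕ) (B : Type*) [CommRing B] (N : ℕ) : Ideal (GLHat p B N) :=
  Ideal.span (Set.range fun v : Fin N × Fin N =>
    GLHat.x p B N v.1 v.2 - (1 : Matrix (Fin N) (Fin N) (GLHat p B N)) v.1 v.2)

/-! ### Higher `π`-derivations and `π`-connections -/

/-- A higher `π`-derivation `δ` of degree `s` on a `π`-torsion free ring `A`, together with the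
associated higher `π`-Frobenius lift `φ`: a ring endomorphism of `A` that reduces to the
`p ^ s`-power map modulo `π`. They determine each other through `φ(a) = a ^ (p ^ s) + π δ(a)`. -/
@[ext]
structure HigherPiDerivation (p s : ℕ) {A : Type*} [CommRing A] (π : A) where
  /-- the higher `π`-Frobenius lift `φ` -/
  lift : A →+* A
  /-- the higher `π`-derivation `δ` -/
  der : A → A
  lift_eq : ∀ a, lift a = a ^ p ^ s + π * der a

/-- A `π`-connection of degree `s` on `GL_N` over `B`: an `n`-tuple of higher `π`-derivations of
degree `s` on `𝒜` extending given higher `π`-derivations `δ_1, …, δ_n` on `B`. -/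
@[ext]
structure PiConnection {p s : ℕ} {B : Type*} [CommRing B] {π : B} {n : ℕ}
    (δ : Fin n → HigherPiDerivation p s π) (N : ℕ) where
  conn : Fin n → HigherPiDerivation p s (algebraMap B (GLHat p B N) π)
  conn_algebraMap : ∀ i b, (conn i).der (algebraMap B (GLHat p B N) b) =
    algebraMap B (GLHat p B N) ((δ i).der b)

/-- The higher `π`-Frobenius lift on `𝒜` extending `φ` on `B` with `x ↦ x^(p^s)`, i.e. the one
of the trivial `π`-connection. -/
def trivialLift {p s : ℕ} [Fact p.Prime] {B : Type*} [CommRing B] {π : B}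
    (δ : HigherPiDerivation p s π) (N : ℕ) : GLHat p B N →+* GLHat p B N :=
  GLHat.lift p ((algebraMap B (GLHat p B N)).comp δ.lift) (GLHat.xPow p B N s)
    (GLHat.isUnit_det_xPow p B N s)

theorem isUnit_det_metric (p : ℕ) {B : Type*} [CommRing B] {N : ℕ}
    (q : Matrix.GeneralLinearGroup (Fin N) B) :
    IsUnit ((GLHat.x p B N).transpose * (q : Matrix (Fin N) (Fin N) B).map
      (algebraMap B (GLHat p B N)) * GLHat.x p B N).det := by
  have hx := GLHat.isUnit_det_x p B N
  have hq : IsUnit ((q : Matrix (Fin N) (Fin N) B).map (algebraMap B (GLHat p B N))).det := by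
    have h := ((Matrix.isUnit_iff_isUnit_det _).1 q.isUnit).map (algebraMap B (GLHat p B N))
    rwa [RingHom.map_det] at h
  rw [Matrix.det_mul, Matrix.det_mul, Matrix.det_transpose]
  exact (hx.mul hq).mul hx

/-- The `B`-algebra map `ℋ_q : 𝒜 → 𝒜`, `x ↦ xᵗ q x`. -/
def metricHom (p : ℕ) {B : Type*} [CommRing B] {N : ℕ}
    (q : Matrix.GeneralLinearGroup (Fin N) B) : GLHat p B N →+* GLHat p B N :=
  GLHat.lift p (algebraMap B (GLHat p B N))
    ((GLHat.x p B N).transpose * (q : Matrix (Fin N) (Fin N) B).map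
      (algebraMap B (GLHat p B N)) * GLHat.x p B N) (isUnit_det_metric p q)

/-- The ring `B[y]^`, with `y = (y_1, …, y_n)` an `n`-tuple of `n × n` matrices of
indeterminates; the variable `(i, j, k)` is the entry `(y_i)_{jk}`. -/
abbrev TorsionRing (p : ℕ) (B : Type*) [CommRing B] (n : ℕ) : Type _ :=
  PComp p (MvPolynomial (Fin n × Fin n × Fin n) B)

/-- The substitution `F ↦ F(Ξ)`, `y_i ↦ Ξ_i`, with values in a `p`-adically complete
`B`-algebra. -/
def TorsionRing.subst (p : ℕ) {B T : Type*} [CommRing B] [CommRing T] [Algebra B T]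
    [IsAdicComplete (Ideal.span {(p : T)}) T] {n : ℕ} (Ξ : Fin n → Matrix (Fin n) (Fin n) T) :
    TorsionRing p B n →+* T :=
  PComp.lift p (MvPolynomial.eval₂Hom (algebraMap B T) fun v => Ξ v.1 v.2.1 v.2.2)

/-- A torsion symbol of the second kind: an `n`-tuple of antisymmetric matrices `L^k`;
`symb k i j` is `L^k_{ij}`. -/
structure TorsionSymbol (p : ℕ) (B : Type*) [CommRing B] (n : ℕ) where
  symb : Fin n → Matrix (Fin n) (Fin n) (TorsionRing p B n)
  antisymm : ∀ k i j, symb k i j + symb k j i = 0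

/-- The torsion symbols of the first kind `L_{ijk} = ∑_m L^m_{ij} (q_{mk})^(p^s)`. -/
def TorsionSymbol.first {p : ℕ} {B : Type*} [CommRing B] {n : ℕ} (L : TorsionSymbol p B n)
    (s : ℕ) (q : Matrix (Fin n) (Fin n) B) (i j k : Fin n) : TorsionRing p B n :=
  ∑ m, L.symb m i j * algebraMap B (TorsionRing p B n) (q m k ^ p ^ s)

namespace PiConnection

variable {p s : ℕ} {B : Type*} [CommRing B] {π : B} {n : ℕ}
  {δ : Fin n → HigherPiDerivation p s π} {N : ℕ}

/-- The Christoffel symbols of the second kind: `Γ_iᵗ = (x^(p^s))⁻¹ δ_i x`. The matrix `x^(p^s)`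
is invertible by `GLHat.isUnit_det_xPow`. The entry `(Γ_i)_{jk}` is `Γ^k_{ij}`. -/
def christoffel (D : PiConnection δ N) (i : Fin n) : Matrix (Fin N) (Fin N) (GLHat p B N) :=
  ((GLHat.xPow p B N s)⁻¹ * (GLHat.x p B N).map (D.conn i).der).transpose

/-- The matrices `Λ_i = (x^(p^s))⁻¹ φ_i(x)`. -/
def lambda (D : PiConnection δ N) (i : Fin n) : Matrix (Fin N) (Fin N) (GLHat p B N) :=
  (GLHat.xPow p B N s)⁻¹ * (GLHat.x p B N).map (D.conn i).lift

/-- The connection is metric with respect to `q`: `ℋ_q ∘ φ_{i,0} = φ_i ∘ ℋ_q` for all `i`. -/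
def IsMetric [Fact p.Prime] (D : PiConnection δ N) (q : Matrix.GeneralLinearGroup (Fin N) B) :
    Prop :=
  ∀ i, (metricHom p q).comp (trivialLift (δ i) N) = (D.conn i).lift.comp (metricHom p q)

/-- For `N = n`, the connection is symmetric with respect to `L`:
`Γ^k_{ij} - Γ^k_{ji} = L^k_{ij}(Λ)`. -/
def IsSymmetric (D : PiConnection δ n) (L : TorsionSymbol p B n) : Prop :=
  ∀ i j k, D.christoffel i j k - D.christoffel j i k =
    TorsionRing.subst p D.lambda (L.symb k i j)

/-- For `N = n`, the Christoffel symbols of the first kind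
`Γ_{ijk} = ∑_m Γ^m_{ij} (q_{mk})^(p^s)`. -/
def christoffelFirst (D : PiConnection δ n) (q : Matrix (Fin n) (Fin n) B) (i j k : Fin n) :
    GLHat p B n :=
  ∑ m, D.christoffel i j m * algebraMap B (GLHat p B n) (q m k ^ p ^ s)

end PiConnection

end LeviCivita
end

/-!
The Levi-Civita equations are solved in the coordinates given by the Christoffel symbols. A
`π`-connection is determined by the matrices `φ_i(x) = x^(p^s) (1 + π Γ_iᵗ)`, and the `Γ_i` may be
prescribed arbitrarily (`PiConnection.christoffel_injective`,
`PiConnection.christoffel_surjective`), because `𝒜` is `π`-torsion free, homomorphisms out of `𝒜`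
are determined by their values on `B` and `x`, and `a ↦ a ^ (p ^ s)` is a ring homomorphism
modulo `π`.

Evaluated at `x`, the metric condition reads `(1 + π Γ_i) P_i (1 + π Γ_iᵗ) = (xᵗ q x)^(p^s)` with
`P_i = (x^(p^s))ᵗ φ_i(q) x^(p^s)`. Both `P_i` and the right-hand side are congruent modulo `π` to
`Q = (x^(p^s))ᵗ q^(p^s) x^(p^s)`, so the equation can be divided by `π` and becomes
`Γ_i Q + Q Γ_iᵗ = C_i + π (⋯)`, where the dots depend polynomially on `Γ`. The symmetry condition
reads `Γ^k_{ij} - Γ^k_{ji} = L^k_{ij}(1 + π Γᵗ)`. Lowering the index with `Q` and applying the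
classical Koszul formula, which needs `2` to be invertible, turns the two conditions into a fixed
point equation for `Γ` (`solvesEquations_iff`). Its right-hand side depends on `Γ` only through
`π Γ`, hence is a contraction for the `π`-adic topology, and there is exactly one fixed point
(`existsUnique_solvesEquations`).

For the congruences, everything is evaluated at `x = 1`. Modulo `π ^ m` the kernel of the evaluation
`𝒜 → B` is `𝒫` (`GLHat.mem_sup_idealP_of_dvd`), and the values of the Christoffel symbols solve the
same kind of equations over `B`, with `-δ_i q` in place of `C_i`
(`PiConnection.solvesEquations_evalOne`). The Koszul formula modulo `π` is the second assertion. In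
the third one `Γ = 0` solves the equations modulo `π ^ m`, so the contraction property forces every
solution to vanish modulo `π ^ m` (`SolvesEquations.pow_dvd`).

The argument works over every `p`-adically complete `B` with a non-zero-divisor `π` that defines the
`p`-adic topology (`IsPseudoUniformizer`). For `R_π`, a power of `π` is divisible by `p` since `π` is
a root of a polynomial congruent to a power of the variable modulo `p`, and `π` divides `p` as soon
as there is a Frobenius lift modulo `π`.
-/

noncomputable section
namespace LeviCivita

/-! ### Elements defining the `p`-adic topology -/

/-- A non-zero-divisor `π` that defines the `p`-adic topology: `π` divides `p`, and `p` divides a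
power of `π`. -/
structure IsPseudoUniformizer (p : ℕ) {B : Type*} [CommRing B] (π : B) : Prop where
  eq_zero_of_mul : ∀ b, π * b = 0 → b = 0
  dvd_prime : π ∣ (p : B)
  exists_dvd_pow : ∃ d : ℕ, (p : B) ∣ π ^ d

namespace IsPseudoUniformizer

variable {p : ℕ} {B : Type*} [CommRing B] {π : B}

theorem mul_left_cancel (h : IsPseudoUniformizer p π) {a b : B} (hab : π * a = π * b) : a = b :=
  sub_eq_zero.1 (h.eq_zero_of_mul _ (by rw [mul_sub, hab, sub_self]))

theorem pow_dvd_of_forall_dvd (h : IsPseudoUniformizer p π) {a : B} (ha : ∀ m, π ^ m ∣ a) (m : ℕ) :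
    (p : B) ^ m ∣ a := by
  obtain ⟨d, hd⟩ := h.exists_dvd_pow
  refine (pow_dvd_pow_of_dvd hd m).trans ?_
  rw [← pow_mul]
  exact ha _

theorem eq_zero_of_forall_pow_dvd [IsAdicComplete (Ideal.span {(p : B)}) B]
    (h : IsPseudoUniformizer p π) {a : B} (ha : ∀ m, π ^ m ∣ a) : a = 0 := by
  refine IsHausdorff.haus (I := Ideal.span {(p : B)}) inferInstance a fun m => ?_
  rw [SModEq.zero, smul_eq_mul, Ideal.mul_top, Ideal.span_singleton_pow, Ideal.mem_span_singleton]
  exact h.pow_dvd_of_forall_dvd ha m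

theorem isUnit_one_add_mul [IsAdicComplete (Ideal.span {(p : B)}) B]
    (h : IsPseudoUniformizer p π) (b : B) : IsUnit (1 + π * b) := by
  obtain ⟨d, hd⟩ := h.exists_dvd_pow
  have hp : (p : B) ∈ (⊥ : Ideal B).jacobson :=
    IsAdicComplete.le_jacobson_bot (Ideal.span {(p : B)}) (Ideal.mem_span_singleton_self _)
  have hd' : π ^ d ∈ (⊥ : Ideal B).jacobson := Ideal.mem_of_dvd _ hd hp
  have hπ : π ∈ (⊥ : Ideal B).jacobson := (Ideal.isRadical_jacobson _) ⟨d, hd'⟩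
  rw [add_comm]
  exact Ideal.mem_jacobson_bot.1 hπ b

/-- A sequence that is Cauchy for the `π`-adic topology converges. -/
theorem exists_limit [IsAdicComplete (Ideal.span {(p : B)}) B] (h : IsPseudoUniformizer p π)
    (f : ℕ → B) (hf : ∀ m, π ^ m ∣ f (m + 1) - f m) : ∃ l, ∀ m, π ^ m ∣ f m - l := by
  obtain ⟨d, hd⟩ := h.exists_dvd_pow
  have hf' : ∀ m n, m ≤ n → π ^ m ∣ f m - f n := by
    intro m n hmn
    induction n, hmn using Nat.le_induction with
    | base => simp
    | succ n hmn ih =>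
      have := dvd_sub ih ((pow_dvd_pow π hmn).trans (hf n))
      rwa [show f m - f n - (f (n + 1) - f n) = f m - f (n + 1) by abel] at this
  -- the terms of index divisible by `d + 1` form a `p`-adic Cauchy sequence
  obtain ⟨l, hl⟩ := IsPrecomplete.prec (I := Ideal.span {(p : B)}) (M := B) inferInstance
    (f := fun m => f ((d + 1) * m)) (by
      intro m n hmn
      rw [SModEq.sub_mem, smul_eq_mul, Ideal.mul_top, Ideal.span_singleton_pow,
        Ideal.mem_span_singleton]
      refine (pow_dvd_pow_of_dvd (hd.trans (pow_dvd_pow π d.le_succ)) m).trans ?_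
      rw [← pow_mul]
      exact hf' _ _ (Nat.mul_le_mul_left _ hmn))
  refine ⟨l, fun m => ?_⟩
  have h1 := hl m
  rw [SModEq.sub_mem, smul_eq_mul, Ideal.mul_top, Ideal.span_singleton_pow,
    Ideal.mem_span_singleton] at h1
  have h2 := hf' m ((d + 1) * m) (Nat.le_mul_of_pos_left _ d.succ_pos)
  have h3 := dvd_add h2 ((pow_dvd_pow_of_dvd h.dvd_prime m).trans h1)
  rwa [sub_add_sub_cancel] at h3

/-- If `B` carries a Frobenius lift modulo `π` of positive degree then `π` divides `p`: the natural
number `p` is congruent to its `p ^ s`-th power modulo `π`. -/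
theorem dvd_prime_of_higherPiDerivation [Fact p.Prime]
    [IsAdicComplete (Ideal.span {(p : B)}) B] {s : ℕ}
    (hs : 1 ≤ s) (δ : HigherPiDerivation p s π) : π ∣ (p : B) := by
  have h1 := δ.lift_eq p
  rw [map_natCast] at h1
  have hp : 2 ≤ p := (Fact.out : p.Prime).two_le
  obtain ⟨t, ht⟩ : ∃ t, p ^ s = t + 2 :=
    ⟨p ^ s - 2, (Nat.sub_add_cancel (hp.trans (Nat.le_self_pow (by omega) p))).symm⟩
  have h2 : π ∣ (p : B) * (1 + p * -(p : B) ^ t) :=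
    ⟨δ.der p, by rw [← sub_eq_iff_eq_add'.2 h1, ht]; ring⟩
  have h3 : (p : B) ∈ (⊥ : Ideal B).jacobson :=
    IsAdicComplete.le_jacobson_bot (Ideal.span {(p : B)}) (Ideal.mem_span_singleton_self _)
  have h4 := Ideal.mem_jacobson_bot.1 h3 (-(p : B) ^ t)
  rw [add_comm] at h4
  exact (h4.dvd_mul_right).1 h2

end IsPseudoUniformizer

theorem isUnit_two {p : ℕ} [Fact p.Prime] (hp : p ≠ 2) (B : Type*) [CommRing B]
    [IsAdicComplete (Ideal.span {(p : B)}) B] : IsUnit (2 : B) := by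
  obtain ⟨k, hk⟩ := (Fact.out : p.Prime).odd_of_ne_two hp
  have h3 : (p : B) ∈ (⊥ : Ideal B).jacobson :=
    IsAdicComplete.le_jacobson_bot (Ideal.span {(p : B)}) (Ideal.mem_span_singleton_self _)
  have h4 := Ideal.mem_jacobson_bot.1 h3 1
  have h5 : (p : B) * 1 + 1 = 2 * (k + 1) := by rw [hk]; push_cast; ring
  rw [h5] at h4
  exact isUnit_of_mul_isUnit_left h4

/-- The non-leading coefficients of the minimal polynomial of `π` over `ℚ_p` are divisible by `p`,
so that `p` divides a power of `π` already in `ℤ_p[π]`. -/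
theorem RPi.exists_dvd_unif_pow (p : ℕ) [Fact p.Prime] (π : PrimeElements p) :
    ∃ d : ℕ, (p : RPi p π) ∣ RPi.unif p π ^ d := by
  obtain ⟨E, -, -, -, -, hlt, -⟩ := π.2
  have hint : IsIntegral ℚ_[p] (π : PadicAlgCl p) := Algebra.IsIntegral.isIntegral _
  have hm := minpoly.monic hint
  set P := minpoly ℚ_[p] (π : PadicAlgCl p) with hP
  have hsp : spectralValue P < 1 := hlt
  have hco : ∀ k < P.natDegree, ∃ e : ℤ_[p], P.coeff k = p * e := by
    intro k hk
    have h1 : ‖P.coeff k‖ < 1 := by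
      by_contra! hc
      have h2 := le_ciSup (spectralValueTerms_bddAbove P) k
      rw [spectralValueTerms_of_lt_natDegree P hk] at h2
      refine absurd (h2.trans_lt hsp) (not_lt.2 (Real.one_le_rpow hc ?_))
      have : (k : ℝ) < P.natDegree := by exact_mod_cast hk
      exact div_nonneg zero_le_one (sub_nonneg.2 this.le)
    obtain ⟨e, he⟩ := (PadicInt.norm_lt_one_iff_dvd (⟨P.coeff k, h1.le⟩ : ℤ_[p])).1 h1
    refine ⟨e, ?_⟩
    have := congrArg (Subtype.val) he
    simpa using this
  choose! e he using hco
  have h0 := minpoly.aeval ℚ_[p] (π : PadicAlgCl p)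
  rw [← hP, Polynomial.aeval_eq_sum_range, Finset.sum_range_succ, hm.coeff_natDegree,
    one_smul] at h0
  refine ⟨P.natDegree, -∑ k ∈ Finset.range P.natDegree,
    algebraMap (RHat p) (RPi p π) ⟨_, mem_RHat_of_padicInt p (e k)⟩ * RPi.unif p π ^ k, ?_⟩
  apply Subtype.ext
  have h1 := congrArg (algebraMap (PadicAlgCl p) ℂ_[p]) (eq_neg_of_add_eq_zero_right h0)
  rw [map_pow] at h1
  refine Eq.trans h1 ?_
  rw [map_neg, map_sum]
  push_cast
  rw [mul_neg, Finset.mul_sum]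
  congr 1
  refine Finset.sum_congr rfl fun k hk => ?_
  rw [he k (Finset.mem_range.1 hk), Algebra.smul_def, map_mul, map_natCast, mul_assoc]
  rfl

theorem RPi.isPseudoUniformizer (p : ℕ) [Fact p.Prime] (π : PrimeElements p) {s : ℕ} (hs : 1 ≤ s)
    (δ : HigherPiDerivation p s (RPi.unif p π)) : IsPseudoUniformizer p (RPi.unif p π) where
  eq_zero_of_mul b hb := by
    have h0 : ((π : PadicAlgCl p) : ℂ_[p]) ≠ 0 := by
      obtain ⟨E, -, -, -, h0, -⟩ := π.2
      exact (map_ne_zero (algebraMap (PadicAlgCl p) ℂ_[p])).2 h0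
    have h1 := congrArg Subtype.val hb
    exact Subtype.ext ((mul_eq_zero.1 h1).resolve_left h0)
  dvd_prime := IsPseudoUniformizer.dvd_prime_of_higherPiDerivation hs δ
  exists_dvd_pow := RPi.exists_dvd_unif_pow p π

/-! ### Homomorphisms out of `p`-adic completions -/

theorem PComp.exists_sub_eq_pow_mul (p : ℕ) {S : Type*} [CommRing S] (a : PComp p S) (m : ℕ) :
    ∃ (c : S) (b : PComp p S), a - algebraMap S _ c = p ^ m * b := by
  obtain ⟨c, hc⟩ := Submodule.Quotient.mk_surjective _
    (AdicCompletion.eval (Ideal.span {(p : S)}) S m a)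
  refine ⟨c, ?_⟩
  have h1 : a - algebraMap S (PComp p S) c ∈
      (AdicCompletion.eval (Ideal.span {(p : S)}) S m).ker := by
    rw [LinearMap.mem_ker, map_sub, sub_eq_zero, ← hc]
    rfl
  rw [← AdicCompletion.pow_smul_top_eq_ker_eval ⟨{(p : S)}, by simp⟩, Ideal.span_singleton_pow,
    Submodule.ideal_span_singleton_smul] at h1
  obtain ⟨b, -, hb⟩ := Submodule.mem_smul_pointwise_iff_exists _ _ _ |>.1 h1
  refine ⟨b, hb.symm.trans ?_⟩
  rw [Algebra.smul_def, map_pow, map_natCast]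

theorem PComp.sub_mem_of_forall (p : ℕ) {S T : Type*} [CommRing S] [CommRing T]
    {f g : PComp p S →+* T} {J : Ideal T} {m : ℕ} (hJ : (p : T) ^ m ∈ J)
    (h : ∀ c, f (algebraMap S _ c) - g (algebraMap S _ c) ∈ J) (a : PComp p S) :
    f a - g a ∈ J := by
  obtain ⟨c, b, hb⟩ := PComp.exists_sub_eq_pow_mul p a m
  rw [sub_eq_iff_eq_add] at hb
  rw [hb, map_add, map_add, map_mul, map_mul, map_pow, map_pow, map_natCast, map_natCast,
    add_sub_add_comm, ← mul_sub]
  exact add_mem (J.mul_mem_right _ hJ) (h c)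

theorem eq_of_forall_sub_mem {p : ℕ} {T : Type*} [CommRing T]
    [IsAdicComplete (Ideal.span {(p : T)}) T] {a b : T}
    (h : ∀ m : ℕ, a - b ∈ Ideal.span {(p : T) ^ m}) : a = b := by
  refine IsHausdorff.eq_iff_smodEq (I := Ideal.span {(p : T)}) |>.2 fun m => ?_
  rw [SModEq.sub_mem, smul_eq_mul, Ideal.mul_top, Ideal.span_singleton_pow]
  exact h m

/-- Two homomorphisms out of `B[x, det(x)⁻¹]` agree as soon as they agree on `B` and on `x`. -/
theorem GLRing.ringHom_ext {B T : Type*} [CommRing B] [CommRing T] {N : ℕ}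
    {f g : GLRing B N →+* T} (hB : ∀ b : B, f (algebraMap B _ b) = g (algebraMap B _ b))
    (hx : ∀ i j, f (algebraMap (MvPolynomial (Fin N × Fin N) B) _ (.X (i, j))) =
      g (algebraMap (MvPolynomial (Fin N × Fin N) B) _ (.X (i, j)))) : f = g := by
  refine IsLocalization.ringHom_ext (Submonoid.powers (Matrix.mvPolynomialX (Fin N) (Fin N) B).det)
    (MvPolynomial.ringHom_ext (fun b => ?_) fun v => hx v.1 v.2)
  have := hB b
  rwa [IsScalarTower.algebraMap_apply B (MvPolynomial (Fin N × Fin N) B) (GLRing B N)] at this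

theorem GLHat.x_apply (p : ℕ) (B : Type*) [CommRing B] (N : ℕ) (i j : Fin N) :
    GLHat.x p B N i j = algebraMap (GLRing B N) (GLHat p B N)
      (algebraMap (MvPolynomial (Fin N × Fin N) B) _ (.X (i, j))) := by
  simp [GLHat.x, Matrix.mvPolynomialX]

theorem GLHat.algebraMap_eq (p : ℕ) (B : Type*) [CommRing B] (N : ℕ) (b : B) :
    algebraMap B (GLHat p B N) b = algebraMap (GLRing B N) _ (algebraMap B _ b) :=
  IsScalarTower.algebraMap_apply B (GLRing B N) (GLHat p B N) b

/-- Homomorphisms out of `𝒜` that are congruent on `B` and on `x` modulo an ideal containing a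
power of `p` are congruent. -/
theorem GLHat.sub_mem_of_forall (p : ℕ) {B T : Type*} [CommRing B] [CommRing T] {N : ℕ}
    {f g : GLHat p B N →+* T} {J : Ideal T} {m : ℕ} (hJ : (p : T) ^ m ∈ J)
    (hB : ∀ b : B, f (algebraMap B _ b) - g (algebraMap B _ b) ∈ J)
    (hx : ∀ i j, f (GLHat.x p B N i j) - g (GLHat.x p B N i j) ∈ J) (a : GLHat p B N) :
    f a - g a ∈ J := by
  refine PComp.sub_mem_of_forall p hJ (fun c => ?_) a
  have h : ((Ideal.Quotient.mk J).comp f).comp (algebraMap (GLRing B N) _) =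
      ((Ideal.Quotient.mk J).comp g).comp (algebraMap (GLRing B N) _) := by
    refine GLRing.ringHom_ext (fun b => ?_) fun i j => ?_
    · simpa [← GLHat.algebraMap_eq] using Ideal.Quotient.eq.2 (hB b)
    · simpa [← GLHat.x_apply] using Ideal.Quotient.eq.2 (hx i j)
  exact Ideal.Quotient.eq.1 (RingHom.congr_fun h c)

theorem GLHat.ringHom_ext (p : ℕ) {B T : Type*} [CommRing B] [CommRing T] {N : ℕ}
    [IsAdicComplete (Ideal.span {(p : T)}) T] {f g : GLHat p B N →+* T}
    (hB : ∀ b : B, f (algebraMap B _ b) = g (algebraMap B _ b))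
    (hx : (GLHat.x p B N).map f = (GLHat.x p B N).map g) : f = g := by
  refine RingHom.ext fun a => eq_of_forall_sub_mem fun m =>
    GLHat.sub_mem_of_forall p (m := m) (Ideal.mem_span_singleton_self _) (fun b => ?_)
      (fun i j => ?_) a
  · rw [hB, sub_self]; exact zero_mem _
  · have : f (GLHat.x p B N i j) = g (GLHat.x p B N i j) := congrFun (congrFun hx i) j
    rw [this, sub_self]; exact zero_mem _

theorem TorsionRing.subst_sub_mem (p : ℕ) {B T : Type*} [CommRing B] [CommRing T] [Algebra B T]
    [IsAdicComplete (Ideal.span {(p : T)}) T] {n : ℕ} {Ξ Ξ' : Fin n → Matrix (Fin n) (Fin n) T}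
    {J : Ideal T} {m : ℕ} (hJ : (p : T) ^ m ∈ J) (h : ∀ i j k, Ξ i j k - Ξ' i j k ∈ J)
    (F : TorsionRing p B n) : subst p Ξ F - subst p Ξ' F ∈ J := by
  refine PComp.sub_mem_of_forall p hJ (fun c => ?_) F
  simp only [subst, PComp.lift_algebraMap]
  rw [← Ideal.Quotient.eq]
  refine RingHom.congr_fun (f := (Ideal.Quotient.mk J).comp (MvPolynomial.eval₂Hom _ _))
    (g := (Ideal.Quotient.mk J).comp (MvPolynomial.eval₂Hom _ _))
    (MvPolynomial.ringHom_ext (fun b => by simp) fun v => ?_) c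
  simpa using Ideal.Quotient.eq.2 (h v.1 v.2.1 v.2.2)

theorem TorsionRing.map_subst (p : ℕ) {B T U : Type*} [CommRing B] [CommRing T] [CommRing U]
    [Algebra B T] [Algebra B U] [IsAdicComplete (Ideal.span {(p : T)}) T]
    [IsAdicComplete (Ideal.span {(p : U)}) U] {n : ℕ} (Ξ : Fin n → Matrix (Fin n) (Fin n) T)
    (f : T →+* U) (hf : ∀ b : B, f (algebraMap B T b) = algebraMap B U b) (F : TorsionRing p B n) :
    f (subst p Ξ F) = subst p (fun i => (Ξ i).map f) F := by
  refine eq_of_forall_sub_mem (p := p) fun m => PComp.sub_mem_of_forall p (m := m)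
    (f := f.comp (subst p Ξ)) (g := subst p (fun i => (Ξ i).map f))
    (Ideal.mem_span_singleton_self _) (fun c => ?_) F
  simp only [subst, RingHom.comp_apply, PComp.lift_algebraMap]
  have : f.comp (MvPolynomial.eval₂Hom (algebraMap B T)
        fun v : Fin n × Fin n × Fin n => Ξ v.1 v.2.1 v.2.2) =
      MvPolynomial.eval₂Hom (algebraMap B U) fun v => (Ξ v.1).map f v.2.1 v.2.2 :=
    MvPolynomial.ringHom_ext (fun b => by simp [hf]) fun v => by simp
  rw [← this, RingHom.comp_apply, sub_self]
  exact zero_mem _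

/-! ### The element `π` of `𝒜` -/

theorem PComp.dvd_of_algebraMap_eq {p : ℕ} {S : Type*} [CommRing S] {c : S} {m : ℕ}
    {z : PComp p S} (h : algebraMap S (PComp p S) c = (p : PComp p S) ^ m * z) :
    (p : S) ^ m ∣ c := by
  have h1 := congrArg (AdicCompletion.evalₐ (Ideal.span {(p : S)}) m) h
  have h2 : Ideal.Quotient.mk (Ideal.span {(p : S)} ^ m) ((p : S) ^ m) = 0 :=
    Ideal.Quotient.eq_zero_iff_mem.2 (Ideal.pow_mem_pow (Ideal.mem_span_singleton_self _) m)
  rw [map_pow, map_natCast] at h2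
  rw [map_mul, map_pow, map_natCast, h2, zero_mul, AdicCompletion.algebraMap_apply] at h1
  have h3 : Ideal.Quotient.mk (Ideal.span {(p : S)} ^ m) c = 0 := by simpa using h1
  rwa [Ideal.Quotient.eq_zero_iff_mem, Ideal.span_singleton_pow, Ideal.mem_span_singleton] at h3

theorem IsPseudoUniformizer.pComp {p : ℕ} {S : Type*} [CommRing S] {π : S}
    (h : IsPseudoUniformizer p π) : IsPseudoUniformizer p (algebraMap S (PComp p S) π) where
  eq_zero_of_mul a ha := by
    obtain ⟨ϖ, hϖ⟩ := h.dvd_prime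
    refine eq_of_forall_sub_mem (p := p) fun m => ?_
    obtain ⟨c, b, hb⟩ := PComp.exists_sub_eq_pow_mul p a (m + 1)
    rw [sub_eq_iff_eq_add] at hb
    -- `p ^ (m + 1)` divides `π c` and equals `π ϖ p ^ m`, so `p ^ m` divides `c`
    have h1 : algebraMap S (PComp p S) (π * c) = (p : PComp p S) ^ (m + 1) *
        -(algebraMap S _ π * b) := by
      rw [hb, mul_add, add_comm] at ha
      rw [map_mul, eq_neg_of_add_eq_zero_left ha]
      ring
    obtain ⟨e, he⟩ := PComp.dvd_of_algebraMap_eq h1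
    have h2 : c = p ^ m * (ϖ * e) := h.mul_left_cancel (by rw [he, pow_succ, hϖ]; ring)
    rw [sub_zero, Ideal.mem_span_singleton, hb, h2, map_mul, map_pow, map_natCast, pow_succ,
      mul_assoc, ← mul_add]
    exact dvd_mul_right _ _
  dvd_prime := by simpa using map_dvd (algebraMap S (PComp p S)) h.dvd_prime
  exists_dvd_pow := by
    obtain ⟨d, hd⟩ := h.exists_dvd_pow
    exact ⟨d, by simpa using map_dvd (algebraMap S (PComp p S)) hd⟩

theorem IsPseudoUniformizer.glRing {p : ℕ} {B : Type*} [CommRing B] {π : B}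
    (h : IsPseudoUniformizer p π) (N : ℕ) :
    IsPseudoUniformizer p (algebraMap B (GLRing B N) π) where
  eq_zero_of_mul a ha := by
    obtain ⟨f, t, rfl⟩ := IsLocalization.exists_mk'_eq
      (Submonoid.powers (Matrix.mvPolynomialX (Fin N) (Fin N) B).det) a
    rw [IsScalarTower.algebraMap_apply B (MvPolynomial (Fin N × Fin N) B) (GLRing B N),
      IsLocalization.mul_mk'_eq_mk'_of_mul, IsLocalization.mk'_eq_zero_iff] at ha
    obtain ⟨u, hu⟩ := ha
    rw [IsLocalization.mk'_eq_zero_iff]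
    refine ⟨u, MvPolynomial.ext _ _ fun e => h.eq_zero_of_mul _ ?_⟩
    have h1 := congrArg (MvPolynomial.coeff e) hu
    rwa [mul_left_comm, MvPolynomial.algebraMap_eq, MvPolynomial.coeff_C_mul] at h1
  dvd_prime := by simpa using map_dvd (algebraMap B (GLRing B N)) h.dvd_prime
  exists_dvd_pow := by
    obtain ⟨d, hd⟩ := h.exists_dvd_pow
    exact ⟨d, by simpa using map_dvd (algebraMap B (GLRing B N)) hd⟩

theorem IsPseudoUniformizer.glHat {p : ℕ} {B : Type*} [CommRing B] {π : B}
    (h : IsPseudoUniformizer p π) (N : ℕ) :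
    IsPseudoUniformizer p (algebraMap B (GLHat p B N) π) := by
  rw [GLHat.algebraMap_eq]
  exact (h.glRing N).pComp

/-! ### The Koszul formula -/

section Koszul

variable {T : Type*} [CommRing T] {n : ℕ}

/-- The right-hand side of the Koszul formula: if the symbols `G_{ijk}` satisfy
`G_{ijk} + G_{ikj} = S_{ijk}` and `G_{ijk} - G_{jik} = U_{ijk}` then `2 G_{ijk}` is this. -/
def koszul (S U : Fin n → Matrix (Fin n) (Fin n) T) (i : Fin n) : Matrix (Fin n) (Fin n) T :=
  Matrix.of fun j k => S i j k + S j i k - S k i j + (U i j k + U k i j - U j k i)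

theorem koszul_apply (S U : Fin n → Matrix (Fin n) (Fin n) T) (i j k : Fin n) :
    koszul S U i j k = S i j k + S j i k - S k i j + (U i j k + U k i j - U j k i) := rfl

theorem two_mul_eq_koszul_iff (h2 : IsUnit (2 : T)) {G S U : Fin n → Matrix (Fin n) (Fin n) T}
    (hS : ∀ i j k, S i j k = S i k j) (hU : ∀ i j k, U i j k + U j i k = 0) :
    (∀ i j k, 2 * G i j k = koszul S U i j k) ↔
      (∀ i j k, G i j k + G i k j = S i j k) ∧ ∀ i j k, G i j k - G j i k = U i j k := by
  constructor
  · intro h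
    simp only [koszul_apply] at h
    refine ⟨fun i j k => h2.mul_left_cancel ?_, fun i j k => h2.mul_left_cancel ?_⟩
    · linear_combination h i j k + h i k j - hS i j k + hU k i j + hU j i k - hU j k i
    · linear_combination h i j k - h j i k - hS k i j - hU i j k - hU k j i + hU k i j
  · rintro ⟨h, h'⟩ i j k
    rw [koszul_apply]
    linear_combination h i j k + h j i k - h k i j + h' i j k + h' k i j - h' j k i

theorem dvd_koszul_sub {a : T} {S U S' U' : Fin n → Matrix (Fin n) (Fin n) T}
    (hS : ∀ i j k, a ∣ S i j k - S' i j k) (hU : ∀ i j k, a ∣ U i j k - U' i j k) (i j k : Fin n) :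
    a ∣ koszul S U i j k - koszul S' U' i j k := by
  have := dvd_add (dvd_sub (dvd_add (hS i j k) (hS j i k)) (hS k i j))
    (dvd_sub (dvd_add (hU i j k) (hU k i j)) (hU j k i))
  convert this using 1
  rw [koszul_apply, koszul_apply]
  ring

theorem dvd_mul_sub_mul {a : T} {M M' : Matrix (Fin n) (Fin n) T}
    (h : ∀ j k, a ∣ M j k - M' j k) (N : Matrix (Fin n) (Fin n) T) (j k : Fin n) :
    a ∣ (M * N) j k - (M' * N) j k := by
  rw [← Matrix.sub_apply, ← sub_mul, Matrix.mul_apply]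
  exact Finset.dvd_sum fun l _ => (h j l).mul_right _

end Koszul

/-! ### The Levi-Civita equations -/

section Equations

variable {T : Type*} [CommRing T] {n : ℕ} (ϖ : T) (Q : Matrix (Fin n) (Fin n) T)
  (E C : Fin n → Matrix (Fin n) (Fin n) T)

/-- The right-hand side of the metric equation
`Γ_i Q + Q Γ_iᵗ = C_i - ϖ (Γ_i E_i + E_i Γ_iᵗ + Γ_i (Q + ϖ E_i) Γ_iᵗ)`. -/
def metricTerm (Γ : Fin n → Matrix (Fin n) (Fin n) T) (i : Fin n) : Matrix (Fin n) (Fin n) T :=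
  C i - ϖ • (Γ i * E i + E i * (Γ i).transpose + Γ i * (Q + ϖ • E i) * (Γ i).transpose)

/-- The equation `(1 + ϖ Γ_i) P_i (1 + ϖ Γ_iᵗ) = P_i + ϖ C_i` for `P_i = Q + ϖ E_i`, divided
by `ϖ`. -/
theorem conj_eq_iff_metricTerm {ϖ : T} (h : ∀ b : T, ϖ * b = 0 → b = 0)
    (Q : Matrix (Fin n) (Fin n) T) (E C Γ : Fin n → Matrix (Fin n) (Fin n) T) (i : Fin n) :
    (1 + ϖ • Γ i) * (Q + ϖ • E i) * (1 + ϖ • (Γ i).transpose) = Q + ϖ • E i + ϖ • C i ↔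
      Γ i * Q + Q * (Γ i).transpose = metricTerm ϖ Q E C Γ i := by
  have h1 : (1 + ϖ • Γ i) * (Q + ϖ • E i) * (1 + ϖ • (Γ i).transpose) -
      (Q + ϖ • E i + ϖ • C i) =
        ϖ • (Γ i * Q + Q * (Γ i).transpose - metricTerm ϖ Q E C Γ i) := by
    simp only [metricTerm, mul_add, add_mul, Matrix.mul_smul, Matrix.smul_mul, mul_one, one_mul]
    module
  rw [← sub_eq_zero, h1, ← sub_eq_zero (a := Γ i * Q + _)]
  refine ⟨fun h2 => Matrix.ext fun j k => h _ ?_, fun h2 => by rw [h2, smul_zero]⟩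
  exact congrFun (congrFun h2 j) k

/-- The symbols `Γ` satisfy the metric equations
`Γ_i Q + Q Γ_iᵗ = C_i - ϖ (Γ_i E_i + E_i Γ_iᵗ + Γ_i (Q + ϖ E_i) Γ_iᵗ)` and have torsion `t`, where
`t_i` has entries `t^k_{ij}`. -/
structure SolvesEquations (t Γ : Fin n → Matrix (Fin n) (Fin n) T) : Prop where
  metric : ∀ i, Γ i * Q + Q * (Γ i).transpose = metricTerm ϖ Q E C Γ i
  torsion : ∀ i j k, Γ i j k - Γ j i k = t i j k

variable {ϖ Q E C}

theorem metricTerm_isSymm (hQ : Q.IsSymm) (hE : ∀ i, (E i).IsSymm) (hC : ∀ i, (C i).IsSymm)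
    (Γ : Fin n → Matrix (Fin n) (Fin n) T) (i : Fin n) : (metricTerm ϖ Q E C Γ i).IsSymm := by
  have h1 := hQ.eq
  have h2 := (hE i).eq
  have h3 := (hC i).eq
  rw [Matrix.IsSymm, metricTerm]
  simp only [Matrix.transpose_sub, Matrix.transpose_smul, Matrix.transpose_add,
    Matrix.transpose_mul, Matrix.transpose_transpose, h1, h2, h3]
  rw [add_comm (E i * _), Matrix.mul_assoc]

theorem dvd_metricTerm_sub {Γ Γ' : Fin n → Matrix (Fin n) (Fin n) T} {m : ℕ}
    (h : ∀ i j k, ϖ ^ m ∣ Γ i j k - Γ' i j k) (i j k : Fin n) :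
    ϖ ^ (m + 1) ∣ metricTerm ϖ Q E C Γ i j k - metricTerm ϖ Q E C Γ' i j k := by
  choose X hX using h
  have hΓ : Γ i = Γ' i + ϖ ^ m • Matrix.of (X i) := by
    ext j k
    simp [← hX]
  set Y := Matrix.of (X i)
  have : metricTerm ϖ Q E C Γ i - metricTerm ϖ Q E C Γ' i = ϖ ^ (m + 1) •
      -(Y * E i + E i * Y.transpose + Y * (Q + ϖ • E i) * (Γ i).transpose +
        Γ' i * (Q + ϖ • E i) * Y.transpose) := by
    simp only [metricTerm]
    generalize Q + ϖ • E i = P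
    have h1 : (Γ i).transpose = (Γ' i).transpose + ϖ ^ m • Y.transpose := by
      rw [hΓ, Matrix.transpose_add, Matrix.transpose_smul]
    have h2 : Γ i * P * (Γ i).transpose = Γ' i * P * (Γ' i).transpose +
        ϖ ^ m • (Y * P * (Γ i).transpose + Γ' i * P * Y.transpose) := by
      nth_rewrite 1 [hΓ]
      rw [add_mul, add_mul]
      nth_rewrite 1 [h1]
      simp only [mul_add, Matrix.mul_smul, Matrix.smul_mul, smul_add]
      abel
    rw [h2]
    nth_rewrite 1 [hΓ]
    nth_rewrite 1 [h1]
    simp only [mul_add, add_mul, Matrix.mul_smul, Matrix.smul_mul, pow_succ]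
    module
  rw [← Matrix.sub_apply, this, Matrix.smul_apply, smul_eq_mul]
  exact dvd_mul_right _ _

theorem SolvesEquations.map {U : Type*} [CommRing U] (f : T →+* U)
    {t Γ : Fin n → Matrix (Fin n) (Fin n) T} (h : SolvesEquations ϖ Q E C t Γ) :
    SolvesEquations (f ϖ) (Q.map f) (fun i => (E i).map f) (fun i => (C i).map f)
      (fun i => (t i).map f) (fun i => (Γ i).map f) where
  metric i := by
    have h1 := congrArg (fun M : Matrix (Fin n) (Fin n) T => M.map f) (h.metric i)
    have hs : ∀ M : Matrix (Fin n) (Fin n) T, (ϖ • M).map f = f ϖ • M.map f := fun M =>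
      Matrix.ext fun j k => by simp
    simpa only [metricTerm, Matrix.map_add _ (map_add f), Matrix.map_sub _ (map_sub f),
      Matrix.map_mul, hs, Matrix.transpose_map] using h1
  torsion i j k := by
    simp only [Matrix.map_apply]
    rw [← map_sub, h.torsion]

/-- Lowering the index with `Q` turns the Levi-Civita equations into the Koszul formula. -/
theorem solvesEquations_iff (h2 : IsUnit (2 : T)) (hQ : Q.IsSymm) (hQ' : IsUnit Q.det)
    (hE : ∀ i, (E i).IsSymm) (hC : ∀ i, (C i).IsSymm) {t Γ : Fin n → Matrix (Fin n) (Fin n) T}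
    (ht : ∀ i j k, t i j k + t j i k = 0) :
    SolvesEquations ϖ Q E C t Γ ↔
      ∀ i j k, 2 * (Γ i * Q) j k =
        koszul (metricTerm ϖ Q E C Γ) (fun i => t i * Q) i j k := by
  rw [two_mul_eq_koszul_iff (G := fun i => Γ i * Q) h2
    (fun i j k => ((metricTerm_isSymm hQ hE hC Γ i).apply j k).symm) (fun i j k => by
      simp only [Matrix.mul_apply, ← Finset.sum_add_distrib, ← add_mul, ht, zero_mul,
        Finset.sum_const_zero])]
  have hsw : ∀ i j k, (Γ i * Q) k j = (Q * (Γ i).transpose) j k := by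
    intro i j k
    rw [← Matrix.transpose_apply (Γ i * Q), Matrix.transpose_mul, hQ.eq]
  constructor
  · rintro ⟨h, h'⟩
    refine ⟨fun i j k => ?_, fun i j k => ?_⟩
    · rw [hsw i j k, ← Matrix.add_apply, h]
    · simp only [Matrix.mul_apply, ← Finset.sum_sub_distrib, ← sub_mul, h']
  · rintro ⟨h, h'⟩
    refine ⟨fun i => ?_, fun i j k => ?_⟩
    · ext j k
      rw [Matrix.add_apply, ← hsw, h]
    · have h3 : (fun l => Γ i j l - Γ j i l) = fun l => t i j l := by
        apply_fun (fun v => Matrix.vecMul v Q) using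
          (Matrix.vecMul_injective_of_isUnit ((Matrix.isUnit_iff_isUnit_det _).2 hQ'))
        ext k
        have h4 := h' i j k
        simp only [Matrix.mul_apply] at h4
        simp only [Matrix.vecMul, dotProduct, sub_mul, Finset.sum_sub_distrib, h4]
      exact congrFun h3 k

/-- Modulo `ϖ` the Levi-Civita equations determine the symbols of the first kind. -/
theorem SolvesEquations.dvd_sub_koszul (h2 : IsUnit (2 : T)) (hQ : Q.IsSymm) (hQ' : IsUnit Q.det)
    (hE : ∀ i, (E i).IsSymm) (hC : ∀ i, (C i).IsSymm) {t t' Γ : Fin n → Matrix (Fin n) (Fin n) T}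
    (ht : ∀ i j k, t i j k + t j i k = 0) (h : SolvesEquations ϖ Q E C t Γ)
    (htt' : ∀ i j k, ϖ ∣ t i j k - t' i j k) (i j k : Fin n) :
    ϖ ∣ 2 * (Γ i * Q) j k - koszul C (fun i => t' i * Q) i j k := by
  rw [(solvesEquations_iff h2 hQ hQ' hE hC ht).1 h]
  refine dvd_koszul_sub (fun i j k => ?_) (fun i => dvd_mul_sub_mul (htt' i) Q) i j k
  rw [← Matrix.sub_apply, metricTerm, sub_sub_cancel_left, ← smul_neg, Matrix.smul_apply,
    smul_eq_mul]
  exact dvd_mul_right _ _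

/-- If `C` and the value at `Γ = 0` of a torsion depending `ϖ`-contractively on `Γ` vanish modulo
`ϖ ^ m` then so does every solution of the Levi-Civita equations: `Γ = 0` is then a solution modulo
`ϖ ^ m`. -/
theorem SolvesEquations.pow_dvd (h2 : IsUnit (2 : T)) (hQ : Q.IsSymm) (hQ' : IsUnit Q.det)
    (hE : ∀ i, (E i).IsSymm) (hC : ∀ i, (C i).IsSymm)
    {t t' Γ : Fin n → Matrix (Fin n) (Fin n) T}
    (ht : ∀ i j k, t i j k + t j i k = 0) (h : SolvesEquations ϖ Q E C t Γ)
    (htt' : ∀ r, (∀ i j k, ϖ ^ r ∣ Γ i j k) → ∀ i j k, ϖ ^ (r + 1) ∣ t i j k - t' i j k) {m : ℕ}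
    (ht' : ∀ i j k, ϖ ^ m ∣ t' i j k) (hCm : ∀ i j k, ϖ ^ m ∣ C i j k) (i j k : Fin n) :
    ϖ ^ m ∣ (Γ i * Q) j k := by
  have key : ∀ r ≤ m, ∀ i j k, ϖ ^ r ∣ Γ i j k := by
    intro r
    induction r with
    | zero => simp
    | succ r ih =>
      intro hr
      have h0 := ih (Nat.le_of_succ_le hr)
      have hpow := pow_dvd_pow ϖ hr
      have h1 : ∀ i j k, ϖ ^ (r + 1) ∣ (Γ i * Q) j k := by
        intro i j k
        rw [← h2.dvd_mul_left (a := ϖ ^ (r + 1)), (solvesEquations_iff h2 hQ hQ' hE hC ht).1 h]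
        have h3 : ∀ i j k, ϖ ^ (r + 1) ∣ metricTerm ϖ Q E C Γ i j k := by
          intro i j k
          have h4 := dvd_metricTerm_sub (Q := Q) (E := E) (C := C) (Γ := Γ) (Γ' := 0)
            (fun i j k => by simpa using h0 i j k) i j k
          refine (dvd_iff_dvd_of_dvd_sub h4).2 ?_
          simpa [metricTerm] using hpow.trans (hCm i j k)
        have h5 : ∀ i j k, ϖ ^ (r + 1) ∣ (t i * Q) j k := fun i j k => by
          rw [Matrix.mul_apply]
          exact Finset.dvd_sum fun l _ => Dvd.dvd.mul_right
            ((dvd_iff_dvd_of_dvd_sub (htt' r h0 i j l)).2 (hpow.trans (ht' i j l))) _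
        exact dvd_add (dvd_sub (dvd_add (h3 _ _ _) (h3 _ _ _)) (h3 _ _ _))
          (dvd_sub (dvd_add (h5 _ _ _) (h5 _ _ _)) (h5 _ _ _))
      intro i j k
      have h6 : Γ i = Γ i * Q * Q⁻¹ := by rw [Matrix.mul_assoc, Matrix.mul_nonsing_inv Q hQ', mul_one]
      rw [h6, Matrix.mul_apply]
      exact Finset.dvd_sum fun l _ => (h1 i j l).mul_right _
  rw [Matrix.mul_apply]
  exact Finset.dvd_sum fun l _ => (key m le_rfl i j l).mul_right _

end Equations

/-! ### Existence and uniqueness of solutions -/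

section FixedPoint

variable {p : ℕ} {T : Type*} [CommRing T] [IsAdicComplete (Ideal.span {(p : T)}) T] {ϖ : T} {n : ℕ}

/-- The contraction principle for the `ϖ`-adic topology. -/
theorem existsUnique_fixedPoint (h : IsPseudoUniformizer p ϖ)
    (Ψ : (Fin n → Matrix (Fin n) (Fin n) T) → Fin n → Matrix (Fin n) (Fin n) T)
    (hΨ : ∀ Γ Γ' m, (∀ i j k, ϖ ^ m ∣ Γ i j k - Γ' i j k) →
      ∀ i j k, ϖ ^ (m + 1) ∣ Ψ Γ i j k - Ψ Γ' i j k) : ∃! Γ, Ψ Γ = Γ := by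
  have hit : ∀ m i j k, ϖ ^ m ∣ (Ψ^[m + 1] 0) i j k - (Ψ^[m] 0) i j k := by
    intro m
    induction m with
    | zero => simp
    | succ m ih =>
      simp only [Function.iterate_succ_apply'] at ih ⊢
      exact hΨ _ _ _ ih
  choose l hl using fun i j k => h.exists_limit (fun m => (Ψ^[m] 0) i j k) fun m => hit m i j k
  refine ⟨fun i => Matrix.of (l i), ?_, fun Γ hΓ => ?_⟩
  · ext i j k
    refine sub_eq_zero.1 (h.eq_zero_of_forall_pow_dvd fun m => ?_)
    have h1 := hΨ (Ψ^[m] 0) (fun i => Matrix.of (l i)) m (fun i j k => hl i j k m) i j k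
    rw [← Function.iterate_succ_apply' Ψ] at h1
    have h2 := dvd_sub (hl i j k (m + 1)) h1
    rw [sub_sub_sub_cancel_left] at h2
    exact (pow_dvd_pow ϖ m.le_succ).trans h2
  · have h1 : ∀ m i j k, ϖ ^ m ∣ Γ i j k - (Ψ^[m] 0) i j k := by
      intro m
      induction m with
      | zero => simp
      | succ m ih =>
        have h2 := hΨ Γ _ m ih
        rwa [hΓ, ← Function.iterate_succ_apply' Ψ] at h2
    ext i j k
    refine sub_eq_zero.1 (h.eq_zero_of_forall_pow_dvd fun m => ?_)
    have h2 := dvd_add (h1 m i j k) (hl i j k m)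
    rwa [sub_add_sub_cancel] at h2

theorem existsUnique_solvesEquations (h : IsPseudoUniformizer p ϖ) (h2 : IsUnit (2 : T))
    {Q : Matrix (Fin n) (Fin n) T} {E C : Fin n → Matrix (Fin n) (Fin n) T}
    (hQ : Q.IsSymm) (hQ' : IsUnit Q.det) (hE : ∀ i, (E i).IsSymm) (hC : ∀ i, (C i).IsSymm)
    (τ : (Fin n → Matrix (Fin n) (Fin n) T) → Fin n → Matrix (Fin n) (Fin n) T)
    (hτ : ∀ Γ i j k, τ Γ i j k + τ Γ j i k = 0)
    (hτ' : ∀ Γ Γ' m, (∀ i j k, ϖ ^ m ∣ Γ i j k - Γ' i j k) →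
      ∀ i j k, ϖ ^ (m + 1) ∣ τ Γ i j k - τ Γ' i j k) :
    ∃! Γ, SolvesEquations ϖ Q E C (τ Γ) Γ := by
  obtain ⟨u, hu⟩ := h2
  have key := existsUnique_fixedPoint h
    (fun Γ i => (↑u⁻¹ : T) • koszul (metricTerm ϖ Q E C Γ) (fun i => τ Γ i * Q) i * Q⁻¹)
    (fun Γ Γ' m hm i => by
      refine dvd_mul_sub_mul (fun j k => ?_) _
      rw [Matrix.smul_apply, Matrix.smul_apply, ← smul_sub, smul_eq_mul]
      exact (dvd_koszul_sub (dvd_metricTerm_sub hm)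
        (fun i => dvd_mul_sub_mul (hτ' Γ Γ' m hm i) Q) i j k).mul_left _)
  refine (existsUnique_congr fun Γ => ?_).1 key
  rw [solvesEquations_iff ⟨u, hu⟩ hQ hQ' hE hC (hτ Γ), funext_iff]
  refine forall_congr' fun i => ?_
  have h3 : (∀ j k, 2 * (Γ i * Q) j k = koszul (metricTerm ϖ Q E C Γ) (fun i => τ Γ i * Q) i j k) ↔
      (2 : T) • (Γ i * Q) = koszul (metricTerm ϖ Q E C Γ) (fun i => τ Γ i * Q) i := by
    rw [← Matrix.ext_iff]
    simp only [Matrix.smul_apply, smul_eq_mul]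
  rw [h3]
  constructor
  · intro h4
    nth_rewrite 1 [← h4]
    rw [Matrix.mul_assoc, Matrix.nonsing_inv_mul Q hQ', mul_one, smul_smul, ← hu,
      Units.mul_inv, one_smul]
  · intro h4
    rw [← h4, smul_smul, ← hu, Units.inv_mul, one_smul, Matrix.mul_assoc,
      Matrix.mul_nonsing_inv Q hQ', mul_one]

end FixedPoint

/-! ### Frobenius lifts on `𝒜` -/

/-- Modulo a divisor of `p`, the `p ^ s`-power map is a ring homomorphism. -/
theorem exists_ringHom_mk_pow {p : ℕ} [Fact p.Prime] {T : Type*} [CommRing T] {ϖ : T}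
    (h : ϖ ∣ (p : T)) (s : ℕ) :
    ∃ F : T →+* T ⧸ Ideal.span {ϖ}, ∀ a, F a = Ideal.Quotient.mk _ (a ^ p ^ s) := by
  rcases subsingleton_or_nontrivial (T ⧸ Ideal.span {ϖ}) with h' | h'
  · exact ⟨Ideal.Quotient.mk _, fun a => Subsingleton.elim _ _⟩
  have hc : CharP (T ⧸ Ideal.span {ϖ}) p := by
    refine (CharP.charP_iff_prime_eq_zero Fact.out).2 ?_
    rw [← map_natCast (Ideal.Quotient.mk (Ideal.span {ϖ})), Ideal.Quotient.eq_zero_iff_mem]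
    exact Ideal.mem_span_singleton.2 h
  exact ⟨(iterateFrobenius _ p s).comp (Ideal.Quotient.mk _), fun a => by
    rw [RingHom.comp_apply, iterateFrobenius_def, map_pow]⟩

theorem dvd_sub_iff_mk_eq {T : Type*} [CommRing T] {ϖ a b : T} :
    ϖ ∣ a - b ↔ Ideal.Quotient.mk (Ideal.span {ϖ}) a = Ideal.Quotient.mk _ b := by
  rw [Ideal.Quotient.eq, Ideal.mem_span_singleton]

/-- An endomorphism of `𝒜` is a Frobenius lift modulo `π` as soon as it is one on `B` and on the
entries of `x`. -/
theorem GLHat.dvd_sub_pow {p : ℕ} [Fact p.Prime] {B : Type*} [CommRing B] {N s : ℕ} {π : B}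
    (h : IsPseudoUniformizer p π) {φ : GLHat p B N →+* GLHat p B N}
    (hB : ∀ b, algebraMap B (GLHat p B N) π ∣ φ (algebraMap B _ b) - algebraMap B _ b ^ p ^ s)
    (hx : ∀ i j, algebraMap B (GLHat p B N) π ∣ φ (x p B N i j) - x p B N i j ^ p ^ s)
    (a : GLHat p B N) : algebraMap B (GLHat p B N) π ∣ φ a - a ^ p ^ s := by
  obtain ⟨F, hF⟩ := exists_ringHom_mk_pow (h.glHat N).dvd_prime s
  have h0 : ∀ a, algebraMap B (GLHat p B N) π ∣ φ a - a ^ p ^ s ↔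
      ((Ideal.Quotient.mk _).comp φ) a - F a ∈
        (⊥ : Ideal (GLHat p B N ⧸ Ideal.span {algebraMap B (GLHat p B N) π})) := by
    intro a
    rw [dvd_sub_iff_mk_eq, hF, Ideal.mem_bot, sub_eq_zero, RingHom.comp_apply]
  simp only [h0] at hB hx ⊢
  refine GLHat.sub_mem_of_forall p (m := 1) ?_ hB hx a
  rw [pow_one, Ideal.mem_bot, ← map_natCast (Ideal.Quotient.mk _), Ideal.Quotient.eq_zero_iff_mem]
  exact Ideal.mem_span_singleton.2 (h.glHat N).dvd_prime

theorem map_transpose_mul_mul {p : ℕ} {B T : Type*} [CommRing B] [CommRing T] {N : ℕ}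
    (M : Matrix (Fin N) (Fin N) (GLHat p B N)) (f : GLHat p B N →+* T) (q : Matrix (Fin N) (Fin N) B) :
    ((M.transpose * q.map (algebraMap B _) * M).map f) =
      (M.map f).transpose * q.map (fun b => f (algebraMap B _ b)) * M.map f := by
  rw [Matrix.map_mul, Matrix.map_mul, Matrix.transpose_map, Matrix.map_map]
  rfl

theorem metricHom_algebraMap (p : ℕ) {B : Type*} [CommRing B] {N : ℕ}
    (q : Matrix.GeneralLinearGroup (Fin N) B) (b : B) :
    metricHom p q (algebraMap B _ b) = algebraMap B _ b :=
  GLHat.lift_algebraMap ..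

theorem map_metricHom_x (p : ℕ) {B : Type*} [CommRing B] {N : ℕ}
    (q : Matrix.GeneralLinearGroup (Fin N) B) :
    (GLHat.x p B N).map (metricHom p q) = (GLHat.x p B N).transpose *
      (q : Matrix (Fin N) (Fin N) B).map (algebraMap B _) * GLHat.x p B N :=
  GLHat.lift_x ..

section

variable {p s : ℕ} [Fact p.Prime] {B : Type*} [CommRing B] {π : B} {n N : ℕ}

theorem trivialLift_algebraMap (δ : HigherPiDerivation p s π) (b : B) :
    trivialLift δ N (algebraMap B _ b) = algebraMap B _ (δ.lift b) :=
  GLHat.lift_algebraMap ..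

theorem map_trivialLift_x (δ : HigherPiDerivation p s π) :
    (GLHat.x p B N).map (trivialLift δ N) = GLHat.xPow p B N s :=
  GLHat.lift_x ..

namespace PiConnection

variable {δ : Fin n → HigherPiDerivation p s π}

omit [Fact p.Prime] in
theorem lift_algebraMap (D : PiConnection δ N) (i : Fin n) (b : B) :
    (D.conn i).lift (algebraMap B _ b) = algebraMap B _ ((δ i).lift b) := by
  rw [(D.conn i).lift_eq, D.conn_algebraMap, (δ i).lift_eq, map_add, map_mul, map_pow]

/-- `δ_i(x) = x^(p^s) Γ_iᵗ` -/
theorem map_der_x (D : PiConnection δ N) (i : Fin n) :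
    (GLHat.x p B N).map (D.conn i).der = GLHat.xPow p B N s * (D.christoffel i).transpose := by
  rw [christoffel, Matrix.transpose_transpose, ← Matrix.mul_assoc,
    Matrix.mul_nonsing_inv _ (GLHat.isUnit_det_xPow p B N s), one_mul]

theorem map_lift_x (D : PiConnection δ N) (i : Fin n) :
    (GLHat.x p B N).map (D.conn i).lift = GLHat.xPow p B N s *
      (1 + algebraMap B (GLHat p B N) π • (D.christoffel i).transpose) := by
  rw [mul_add, mul_one, Matrix.mul_smul, ← map_der_x]
  exact Matrix.ext fun j k => (D.conn i).lift_eq _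

theorem lambda_eq (D : PiConnection δ N) (i : Fin n) :
    D.lambda i = 1 + algebraMap B (GLHat p B N) π • (D.christoffel i).transpose := by
  rw [lambda, map_lift_x, ← Matrix.mul_assoc,
    Matrix.nonsing_inv_mul _ (GLHat.isUnit_det_xPow p B N s), one_mul]

theorem christoffel_injective (h : IsPseudoUniformizer p π) :
    Function.Injective (christoffel : PiConnection δ N → _) := by
  intro D D' hD
  have hl : ∀ i, (D.conn i).lift = (D'.conn i).lift := fun i =>
    GLHat.ringHom_ext p (fun b => by rw [lift_algebraMap, lift_algebraMap])
      (by rw [map_lift_x, map_lift_x, hD])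
  refine PiConnection.ext (funext fun i => HigherPiDerivation.ext (hl i) (funext fun a => ?_))
  refine (h.glHat N).mul_left_cancel (add_left_cancel (a := a ^ p ^ s) ?_)
  rw [← (D.conn i).lift_eq, ← (D'.conn i).lift_eq, hl]

/-- Every tuple of matrices consists of the Christoffel symbols of a `π`-connection: the formula
`φ_i(x) = x^(p^s) (1 + π Γ_iᵗ)` prescribes a Frobenius lift. -/
theorem christoffel_surjective (h : IsPseudoUniformizer p π) :
    Function.Surjective (christoffel : PiConnection δ N → _) := by
  intro Γ
  let M : Fin n → Matrix (Fin N) (Fin N) (GLHat p B N) := fun i =>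
    GLHat.xPow p B N s * (1 + algebraMap B (GLHat p B N) π • (Γ i).transpose)
  have hM : ∀ i, IsUnit (M i).det := by
    intro i
    rw [Matrix.det_mul]
    refine (GLHat.isUnit_det_xPow p B N s).mul ?_
    obtain ⟨c, hc⟩ : algebraMap B (GLHat p B N) π ∣
        (1 + algebraMap B (GLHat p B N) π • (Γ i).transpose).det - 1 := by
      have h1 : (Ideal.Quotient.mk (Ideal.span {algebraMap B (GLHat p B N) π})).mapMatrix
          (1 + algebraMap B (GLHat p B N) π • (Γ i).transpose) = 1 := by
        rw [map_add, map_one, add_eq_left]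
        refine Matrix.ext fun j k => Ideal.Quotient.eq_zero_iff_mem.2 ?_
        exact Ideal.mul_mem_right _ _ (Ideal.mem_span_singleton_self _)
      rw [dvd_sub_iff_mk_eq, RingHom.map_det, h1, map_one, Matrix.det_one]
    rw [sub_eq_iff_eq_add'.1 hc]
    exact (h.glHat N).isUnit_one_add_mul c
  let φ : Fin n → GLHat p B N →+* GLHat p B N := fun i =>
    GLHat.lift p ((algebraMap B (GLHat p B N)).comp (δ i).lift) (M i) (hM i)
  have hφB : ∀ i b, φ i (algebraMap B _ b) = algebraMap B _ ((δ i).lift b) := fun i b =>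
    GLHat.lift_algebraMap ..
  have hφx : ∀ i j k, φ i (GLHat.x p B N j k) = GLHat.x p B N j k ^ p ^ s +
      algebraMap B _ π * (GLHat.xPow p B N s * (Γ i).transpose) j k := by
    intro i j k
    have h1 : (GLHat.x p B N).map (φ i) = M i := GLHat.lift_x ..
    have h2 := congrFun (congrFun h1 j) k
    rw [Matrix.map_apply] at h2
    rw [h2]
    simp only [M, mul_add, mul_one, Matrix.mul_smul, Matrix.add_apply, Matrix.smul_apply,
      smul_eq_mul]
    rfl
  have hφ : ∀ i a, algebraMap B (GLHat p B N) π ∣ φ i a - a ^ p ^ s := fun i =>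
    GLHat.dvd_sub_pow h
      (fun b => ⟨algebraMap B _ ((δ i).der b), by
        rw [hφB, (δ i).lift_eq, map_add, map_mul, map_pow, add_sub_cancel_left]⟩)
      (fun j k => by rw [hφx, add_sub_cancel_left]; exact dvd_mul_right _ _)
  choose d hd using hφ
  let D : PiConnection δ N :=
    { conn := fun i => ⟨φ i, d i, fun a => sub_eq_iff_eq_add'.1 (hd i a)⟩
      conn_algebraMap := fun i b => (h.glHat N).mul_left_cancel (by
        rw [← hd, hφB, (δ i).lift_eq, map_add, map_mul, map_pow, add_sub_cancel_left]) }
  refine ⟨D, funext fun i => ?_⟩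
  have h3 : (GLHat.x p B N).map (D.conn i).der = GLHat.xPow p B N s * (Γ i).transpose := by
    refine Matrix.ext fun j k => (h.glHat N).mul_left_cancel ?_
    rw [Matrix.map_apply, ← add_right_inj (GLHat.x p B N j k ^ p ^ s), ← hφx]
    exact ((D.conn i).lift_eq _).symm
  rw [christoffel, h3, ← Matrix.mul_assoc,
    Matrix.nonsing_inv_mul _ (GLHat.isUnit_det_xPow p B N s), one_mul, Matrix.transpose_transpose]

end PiConnection

/-! ### The metric condition as an equation between matrices -/

/-- The form `(x^(p^s))ᵗ M x^(p^s)` over `𝒜`, for a matrix `M` over `B`. -/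
def pullback (p s : ℕ) {B : Type*} [CommRing B] {N : ℕ} (M : Matrix (Fin N) (Fin N) B) :
    Matrix (Fin N) (Fin N) (GLHat p B N) :=
  (GLHat.xPow p B N s).transpose * M.map (algebraMap B _) * GLHat.xPow p B N s

omit [Fact p.Prime] in
theorem pullback_isSymm {M : Matrix (Fin N) (Fin N) B} (hM : M.IsSymm) : (pullback p s M).IsSymm := by
  rw [Matrix.IsSymm, pullback, Matrix.transpose_mul, Matrix.transpose_mul,
    Matrix.transpose_transpose, Matrix.mul_assoc, ← Matrix.transpose_map, hM.eq]

theorem isUnit_det_pullback {M : Matrix (Fin N) (Fin N) B} (hM : IsUnit M.det) :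
    IsUnit (pullback p s M).det := by
  have h := hM.map (algebraMap B (GLHat p B N))
  rw [RingHom.map_det] at h
  rw [pullback, Matrix.det_mul, Matrix.det_mul, Matrix.det_transpose]
  exact ((GLHat.isUnit_det_xPow p B N s).mul h).mul (GLHat.isUnit_det_xPow p B N s)

omit [Fact p.Prime] in
theorem pullback_lift (δ : HigherPiDerivation p s π) (q : Matrix (Fin N) (Fin N) B) :
    pullback p s (q.map δ.lift) = pullback p s (q.map (· ^ p ^ s)) +
      algebraMap B (GLHat p B N) π • pullback p s (q.map δ.der) := by
  have h : q.map δ.lift = q.map (· ^ p ^ s) + π • q.map δ.der := by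
    exact Matrix.ext fun j k => δ.lift_eq _
  rw [h]
  simp only [pullback]
  rw [← Matrix.smul_mul, ← Matrix.mul_smul, ← add_mul, ← mul_add]
  congr 2
  refine Matrix.ext fun j k => ?_
  simp only [Matrix.map_apply, Matrix.add_apply, Matrix.smul_apply, smul_eq_mul, map_add, map_mul]

/-- The form `(xᵗ q x)^(p^s)` over `𝒜`. -/
def metricPow (p s : ℕ) {B : Type*} [CommRing B] {N : ℕ} (q : Matrix (Fin N) (Fin N) B) :
    Matrix (Fin N) (Fin N) (GLHat p B N) :=
  ((GLHat.x p B N).transpose * q.map (algebraMap B _) * GLHat.x p B N).map (· ^ p ^ s)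

omit [Fact p.Prime] in
theorem metricPow_isSymm {q : Matrix (Fin N) (Fin N) B} (hq : q.IsSymm) :
    (metricPow p s q).IsSymm := by
  rw [Matrix.IsSymm, metricPow, ← Matrix.transpose_map, Matrix.transpose_mul, Matrix.transpose_mul,
    Matrix.transpose_transpose, Matrix.mul_assoc, ← Matrix.transpose_map, hq.eq]

/-- Both sides of the metric condition are determined by the image of `x`. -/
theorem PiConnection.isMetric_iff {δ : Fin n → HigherPiDerivation p s π} (D : PiConnection δ N)
    (q : Matrix.GeneralLinearGroup (Fin N) B) :
    D.IsMetric q ↔ ∀ i,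
      (1 + algebraMap B (GLHat p B N) π • D.christoffel i) *
        pullback p s ((q : Matrix (Fin N) (Fin N) B).map (δ i).lift) *
        (1 + algebraMap B (GLHat p B N) π • (D.christoffel i).transpose) =
      metricPow p s (q : Matrix (Fin N) (Fin N) B) := by
  refine forall_congr' fun i => ?_
  have h1 : (GLHat.x p B N).map ((metricHom p q).comp (trivialLift (δ i) N)) =
      metricPow p s (q : Matrix (Fin N) (Fin N) B) := by
    rw [RingHom.coe_comp, ← Matrix.map_map, map_trivialLift_x, metricPow, ← map_metricHom_x]
    refine Matrix.ext fun j k => ?_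
    simp only [GLHat.xPow, Matrix.map_apply, map_pow]
  have h2 : (GLHat.x p B N).map ((D.conn i).lift.comp (metricHom p q)) =
      (1 + algebraMap B (GLHat p B N) π • D.christoffel i) *
        pullback p s ((q : Matrix (Fin N) (Fin N) B).map (δ i).lift) *
        (1 + algebraMap B (GLHat p B N) π • (D.christoffel i).transpose) := by
    rw [RingHom.coe_comp, ← Matrix.map_map, map_metricHom_x, map_transpose_mul_mul, D.map_lift_x,
      Matrix.transpose_mul, Matrix.transpose_add, Matrix.transpose_one, Matrix.transpose_smul,
      Matrix.transpose_transpose, pullback, Matrix.map_map]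
    simp only [D.lift_algebraMap, Matrix.mul_assoc]
    rfl
  rw [← h1, ← h2]
  constructor
  · intro h
    rw [h]
  · intro h
    refine GLHat.ringHom_ext p (fun b => ?_) h.symm
    simp only [RingHom.comp_apply, trivialLift_algebraMap, metricHom_algebraMap,
      D.lift_algebraMap]

theorem dvd_metricPow_sub (h : IsPseudoUniformizer p π) (δ : HigherPiDerivation p s π)
    (q : Matrix (Fin N) (Fin N) B) (j k : Fin N) :
    algebraMap B (GLHat p B N) π ∣ metricPow p s q j k - pullback p s (q.map δ.lift) j k := by
  obtain ⟨F, hF⟩ := exists_ringHom_mk_pow (h.glHat N).dvd_prime s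
  have h1 : ∀ b, Ideal.Quotient.mk (Ideal.span {algebraMap B (GLHat p B N) π})
      (algebraMap B _ (δ.lift b)) = F (algebraMap B _ b) := by
    intro b
    rw [hF, ← dvd_sub_iff_mk_eq]
    exact ⟨algebraMap B _ (δ.der b), by
      rw [δ.lift_eq, map_add, map_mul, map_pow, add_sub_cancel_left]⟩
  have h2 : ∀ j k, Ideal.Quotient.mk (Ideal.span {algebraMap B (GLHat p B N) π})
      (GLHat.xPow p B N s j k) = F (GLHat.x p B N j k) := fun j k => (hF _).symm
  rw [dvd_sub_iff_mk_eq]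
  simp only [metricPow, pullback, Matrix.map_apply]
  rw [← hF]
  simp only [Matrix.mul_apply, Matrix.transpose_apply, Matrix.map_apply, map_sum, map_mul, h1, h2]

end

/-! ### Evaluation at `x = 1` -/

section Evaluation

variable (p : ℕ) (B : Type*) [CommRing B] [IsAdicComplete (Ideal.span {(p : B)}) B] (N : ℕ)

/-- The evaluation `𝒜 → B` at `x = 1`. -/
def GLHat.evalOne : GLHat p B N →+* B :=
  GLHat.lift p (RingHom.id B) 1 (by rw [Matrix.det_one]; exact isUnit_one)

variable {p B N}

theorem GLHat.evalOne_algebraMap (b : B) : evalOne p B N (algebraMap B _ b) = b :=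
  GLHat.lift_algebraMap ..

theorem GLHat.map_evalOne_x : (x p B N).map (evalOne p B N) = 1 :=
  GLHat.lift_x ..

theorem GLHat.map_evalOne_xPow [Fact p.Prime] (s : ℕ) : (xPow p B N s).map (evalOne p B N) = 1 := by
  refine Matrix.ext fun j k => ?_
  have h : evalOne p B N (x p B N j k) = (1 : Matrix (Fin N) (Fin N) B) j k :=
    congrFun (congrFun map_evalOne_x j) k
  have hp : p ^ s ≠ 0 := pow_ne_zero s (Fact.out : p.Prime).ne_zero
  simp only [xPow, Matrix.map_apply, map_pow, h]
  rcases eq_or_ne j k with rfl | hjk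
  · rw [Matrix.one_apply_eq, one_pow]
  · rw [Matrix.one_apply_ne hjk, zero_pow hp]

/-- Modulo `π ^ m`, the kernel of the evaluation at `x = 1` is the ideal `𝒫`. -/
theorem GLHat.mem_sup_idealP_of_dvd {π : B} (h : IsPseudoUniformizer p π) {m : ℕ}
    {a : GLHat p B N} (ha : π ^ m ∣ evalOne p B N a) :
    a ∈ Ideal.span {algebraMap B (GLHat p B N) π ^ m} ⊔ idealP p B N := by
  have h1 : RingHom.id _ a - (algebraMap B (GLHat p B N)).comp (evalOne p B N) a ∈
      Ideal.span {algebraMap B (GLHat p B N) π ^ m} ⊔ idealP p B N := by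
    refine GLHat.sub_mem_of_forall p (m := m) ?_ (fun b => ?_) (fun i j => ?_) a
    · exact Ideal.mem_sup_left (Ideal.mem_span_singleton.2
        (pow_dvd_pow_of_dvd (h.glHat N).dvd_prime m))
    · rw [RingHom.comp_apply, evalOne_algebraMap, RingHom.id_apply, sub_self]
      exact zero_mem _
    · have h2 : evalOne p B N (x p B N i j) = (1 : Matrix (Fin N) (Fin N) B) i j :=
        congrFun (congrFun map_evalOne_x i) j
      have h3 : algebraMap B (GLHat p B N) ((1 : Matrix (Fin N) (Fin N) B) i j) =
          (1 : Matrix (Fin N) (Fin N) (GLHat p B N)) i j := by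
        rcases eq_or_ne i j with rfl | hij
        · rw [Matrix.one_apply_eq, Matrix.one_apply_eq, map_one]
        · rw [Matrix.one_apply_ne hij, Matrix.one_apply_ne hij, map_zero]
      rw [RingHom.comp_apply, h2, h3, RingHom.id_apply]
      exact Ideal.mem_sup_right (Ideal.subset_span ⟨(i, j), rfl⟩)
  have h2 : algebraMap B (GLHat p B N) (evalOne p B N a) ∈
      Ideal.span {algebraMap B (GLHat p B N) π ^ m} ⊔ idealP p B N := by
    refine Ideal.mem_sup_left (Ideal.mem_span_singleton.2 ?_)
    rw [← map_pow]
    exact map_dvd _ ha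
  have h3 := add_mem h1 h2
  rwa [RingHom.comp_apply, RingHom.id_apply, sub_add_cancel] at h3

theorem map_evalOne_pullback [Fact p.Prime] (s : ℕ) (M : Matrix (Fin N) (Fin N) B) :
    (pullback p s M).map (GLHat.evalOne p B N) = M := by
  rw [pullback, map_transpose_mul_mul, GLHat.map_evalOne_xPow, Matrix.transpose_one, one_mul, mul_one]
  refine Matrix.ext fun j k => ?_
  rw [Matrix.map_apply, GLHat.evalOne_algebraMap]

theorem evalOne_metricPow [Fact p.Prime] (s : ℕ) (q : Matrix (Fin N) (Fin N) B) (j k : Fin N) :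
    GLHat.evalOne p B N (metricPow p s q j k) = q j k ^ p ^ s := by
  have h : ((GLHat.x p B N).transpose * q.map (algebraMap B _) * GLHat.x p B N).map
      (GLHat.evalOne p B N) = q := by
    rw [map_transpose_mul_mul, GLHat.map_evalOne_x, Matrix.transpose_one, one_mul, mul_one]
    refine Matrix.ext fun j k => ?_
    rw [Matrix.map_apply, GLHat.evalOne_algebraMap]
  rw [metricPow, Matrix.map_apply, map_pow, ← Matrix.map_apply (f := GLHat.evalOne p B N), h]

end Evaluation

/-! ### The Levi-Civita connection -/

section LeviCivitaConnection

variable {p s : ℕ} {B : Type*} [CommRing B] {π : B} {n : ℕ}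

/-- The torsion `L^k_{ij}(1 + ϖ Γ_1ᵗ, …, 1 + ϖ Γ_nᵗ)` that the torsion symbol `L` prescribes to
the Christoffel symbols `Γ`. -/
def TorsionSymbol.torsion {T : Type*} [CommRing T] [Algebra B T]
    [IsAdicComplete (Ideal.span {(p : T)}) T] (L : TorsionSymbol p B n) (ϖ : T)
    (Γ : Fin n → Matrix (Fin n) (Fin n) T) (i : Fin n) : Matrix (Fin n) (Fin n) T :=
  Matrix.of fun j k => TorsionRing.subst p (fun l => 1 + ϖ • (Γ l).transpose) (L.symb k i j)

namespace TorsionSymbol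

variable {T : Type*} [CommRing T] [Algebra B T] [IsAdicComplete (Ideal.span {(p : T)}) T]

theorem torsion_apply (L : TorsionSymbol p B n) (ϖ : T) (Γ : Fin n → Matrix (Fin n) (Fin n) T)
    (i j k : Fin n) : L.torsion ϖ Γ i j k =
      TorsionRing.subst p (fun l => 1 + ϖ • (Γ l).transpose) (L.symb k i j) := rfl

theorem torsion_add_swap (L : TorsionSymbol p B n) (ϖ : T)
    (Γ : Fin n → Matrix (Fin n) (Fin n) T) (i j k : Fin n) :
    L.torsion ϖ Γ i j k + L.torsion ϖ Γ j i k = 0 := by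
  rw [torsion_apply, torsion_apply, ← map_add, L.antisymm, map_zero]

theorem dvd_torsion_sub (L : TorsionSymbol p B n) {ϖ : T} (h : IsPseudoUniformizer p ϖ)
    (Γ Γ' : Fin n → Matrix (Fin n) (Fin n) T) (m : ℕ) (hm : ∀ i j k, ϖ ^ m ∣ Γ i j k - Γ' i j k)
    (i j k : Fin n) : ϖ ^ (m + 1) ∣ L.torsion ϖ Γ i j k - L.torsion ϖ Γ' i j k := by
  rw [← Ideal.mem_span_singleton, torsion_apply, torsion_apply]
  refine TorsionRing.subst_sub_mem p (m := m + 1)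
    (Ideal.mem_span_singleton.2 (pow_dvd_pow_of_dvd h.dvd_prime _)) (fun l a b => ?_) _
  rw [Ideal.mem_span_singleton, ← Matrix.sub_apply, add_sub_add_left_eq_sub, ← smul_sub,
    Matrix.smul_apply, smul_eq_mul, pow_succ']
  exact mul_dvd_mul_left ϖ (hm l b a)

end TorsionSymbol

variable [Fact p.Prime]

omit [Fact p.Prime] in
theorem TorsionSymbol.torsion_zero_mul [IsAdicComplete (Ideal.span {(p : B)}) B]
    (L : TorsionSymbol p B n) (q : Matrix (Fin n) (Fin n) B) (i j k : Fin n) :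
    (L.torsion π (0 : Fin n → Matrix (Fin n) (Fin n) B) i * q.map (· ^ p ^ s)) j k =
      TorsionRing.subst p (fun _ => (1 : Matrix (Fin n) (Fin n) B)) (L.first s q i j k) := by
  have h : ∀ b : B, TorsionRing.subst p (fun _ => (1 : Matrix (Fin n) (Fin n) B))
      (algebraMap B (TorsionRing p B n) b) = b := by
    intro b
    rw [IsScalarTower.algebraMap_apply B (MvPolynomial (Fin n × Fin n × Fin n) B),
      TorsionRing.subst, PComp.lift_algebraMap]
    simp
  rw [Matrix.mul_apply, first, map_sum]
  refine Finset.sum_congr rfl fun m _ => ?_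
  rw [map_mul, h, L.torsion_apply]
  simp

/-- The matrices `C_i` with `(xᵗ q x)^(p^s) = P_i + π C_i`, where
`P_i = (x^(p^s))ᵗ φ_i(q) x^(p^s)`. -/
theorem exists_metricPow_eq (h : IsPseudoUniformizer p π) (δ : HigherPiDerivation p s π)
    {q : Matrix (Fin n) (Fin n) B} (hq : q.IsSymm) :
    ∃ C : Matrix (Fin n) (Fin n) (GLHat p B n), C.IsSymm ∧
      metricPow p s q = pullback p s (q.map (· ^ p ^ s)) +
        algebraMap B (GLHat p B n) π • pullback p s (q.map δ.der) +
        algebraMap B (GLHat p B n) π • C := by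
  choose C hC using dvd_metricPow_sub h δ q
  have hC' : metricPow p s q = pullback p s (q.map δ.lift) +
      algebraMap B (GLHat p B n) π • Matrix.of C :=
    Matrix.ext fun j k => sub_eq_iff_eq_add'.1 (hC j k)
  refine ⟨Matrix.of C, Matrix.ext fun j k => (h.glHat n).mul_left_cancel ?_, ?_⟩
  · have hs : (q.map δ.lift).IsSymm := hq.map _
    rw [Matrix.transpose_apply, Matrix.of_apply, Matrix.of_apply, ← hC, ← hC,
      (metricPow_isSymm hq).apply, (pullback_isSymm hs).apply]
  · rw [hC', pullback_lift]

/-- Metric connections that are symmetric with respect to `L` correspond to solutions of the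
Levi-Civita equations over `𝒜`. -/
theorem PiConnection.isMetric_and_isSymmetric_iff (h : IsPseudoUniformizer p π)
    {δ : Fin n → HigherPiDerivation p s π} (D : PiConnection δ n)
    (q : Matrix.GeneralLinearGroup (Fin n) B) (L : TorsionSymbol p B n)
    {C : Fin n → Matrix (Fin n) (Fin n) (GLHat p B n)}
    (hC : ∀ i, metricPow p s (q : Matrix (Fin n) (Fin n) B) =
      pullback p s ((q : Matrix (Fin n) (Fin n) B).map (· ^ p ^ s)) +
        algebraMap B (GLHat p B n) π • pullback p s ((q : Matrix (Fin n) (Fin n) B).map (δ i).der) +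
        algebraMap B (GLHat p B n) π • C i) :
    D.IsMetric q ∧ D.IsSymmetric L ↔
      SolvesEquations (algebraMap B (GLHat p B n) π)
        (pullback p s ((q : Matrix (Fin n) (Fin n) B).map (· ^ p ^ s)))
        (fun i => pullback p s ((q : Matrix (Fin n) (Fin n) B).map (δ i).der)) C
        (L.torsion (algebraMap B (GLHat p B n) π) D.christoffel) D.christoffel := by
  have h1 : D.IsMetric q ↔ ∀ i,
      D.christoffel i * pullback p s ((q : Matrix (Fin n) (Fin n) B).map (· ^ p ^ s)) +
        pullback p s ((q : Matrix (Fin n) (Fin n) B).map (· ^ p ^ s)) *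
          (D.christoffel i).transpose =
      metricTerm (algebraMap B (GLHat p B n) π)
        (pullback p s ((q : Matrix (Fin n) (Fin n) B).map (· ^ p ^ s)))
        (fun i => pullback p s ((q : Matrix (Fin n) (Fin n) B).map (δ i).der)) C
        D.christoffel i := by
    rw [D.isMetric_iff q]
    refine forall_congr' fun i => ?_
    rw [hC i, pullback_lift]
    exact conj_eq_iff_metricTerm (h.glHat n).eq_zero_of_mul _
      (fun i => pullback p s ((q : Matrix (Fin n) (Fin n) B).map (δ i).der)) C D.christoffel i
  have h2 : D.lambda = fun l => 1 + algebraMap B (GLHat p B n) π • (D.christoffel l).transpose :=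
    funext D.lambda_eq
  rw [h1, IsSymmetric, h2]
  exact ⟨fun h => ⟨h.1, h.2⟩, fun h => ⟨h.1, h.2⟩⟩

theorem isUnit_det_map_pow [IsAdicComplete (Ideal.span {(p : B)}) B]
    (q : Matrix.GeneralLinearGroup (Fin n) B) :
    IsUnit ((q : Matrix (Fin n) (Fin n) B).map (· ^ p ^ s)).det := by
  obtain ⟨F, hF⟩ := exists_ringHom_mk_pow (dvd_refl (p : B)) s
  apply isUnit_of_isUnit_mk (p := p)
  have h1 : (Ideal.Quotient.mk (Ideal.span {(p : B)})).mapMatrix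
      ((q : Matrix (Fin n) (Fin n) B).map (· ^ p ^ s)) = F.mapMatrix q :=
    Matrix.ext fun j k => (hF _).symm
  rw [RingHom.map_det, h1, ← RingHom.map_det]
  exact ((Matrix.isUnit_iff_isUnit_det _).1 q.isUnit).map F

theorem existsUnique_isMetric_isSymmetric [IsAdicComplete (Ideal.span {(p : B)}) B]
    (hp : p ≠ 2) (h : IsPseudoUniformizer p π)
    (δ : Fin n → HigherPiDerivation p s π) (q : Matrix.GeneralLinearGroup (Fin n) B)
    (hq : (q : Matrix (Fin n) (Fin n) B).IsSymm) (L : TorsionSymbol p B n) :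
    ∃! D : PiConnection δ n, D.IsMetric q ∧ D.IsSymmetric L := by
  choose C hCs hC using fun i => exists_metricPow_eq h (δ i) hq
  have key := existsUnique_solvesEquations (h.glHat n) (isUnit_two hp (GLHat p B n))
    (pullback_isSymm (s := s) (p := p) (hq.map (· ^ p ^ s)))
    (isUnit_det_pullback (isUnit_det_map_pow q))
    (fun i => pullback_isSymm (s := s) (hq.map (δ i).der)) hCs
    (L.torsion (algebraMap B (GLHat p B n) π)) (L.torsion_add_swap _)
    (L.dvd_torsion_sub (h.glHat n))
  simp only [PiConnection.isMetric_and_isSymmetric_iff h _ q L hC]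
  obtain ⟨Γ, hΓ, hu⟩ := key
  obtain ⟨D, rfl⟩ := PiConnection.christoffel_surjective (δ := δ) h Γ
  exact ⟨D, hΓ, fun D' hD' => PiConnection.christoffel_injective h (hu _ hD')⟩

/-- The values of the Christoffel symbols at `x = 1` solve Levi-Civita equations over `B`, in which
`-δ_i q` takes the place of `C_i`. -/
theorem PiConnection.solvesEquations_evalOne [IsAdicComplete (Ideal.span {(p : B)}) B]
    (h : IsPseudoUniformizer p π)
    {δ : Fin n → HigherPiDerivation p s π} {D : PiConnection δ n}
    {q : Matrix.GeneralLinearGroup (Fin n) B}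
    (hq : (q : Matrix (Fin n) (Fin n) B).IsSymm) {L : TorsionSymbol p B n}
    (hD : D.IsMetric q) (hD' : D.IsSymmetric L) :
    SolvesEquations π ((q : Matrix (Fin n) (Fin n) B).map (· ^ p ^ s))
      (fun i => (q : Matrix (Fin n) (Fin n) B).map (δ i).der)
      (fun i => -(q : Matrix (Fin n) (Fin n) B).map (δ i).der)
      (L.torsion π fun i => (D.christoffel i).map (GLHat.evalOne p B n))
      (fun i => (D.christoffel i).map (GLHat.evalOne p B n)) := by
  choose C hCs hC using fun i => exists_metricPow_eq h (δ i) hq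
  have h1 := ((D.isMetric_and_isSymmetric_iff h q L hC).1 ⟨hD, hD'⟩).map (GLHat.evalOne p B n)
  simp only [map_evalOne_pullback, GLHat.evalOne_algebraMap] at h1
  have h2 : (fun i => (C i).map (GLHat.evalOne p B n)) =
      fun i => -(q : Matrix (Fin n) (Fin n) B).map (δ i).der := by
    refine funext fun i => Matrix.ext fun j k => h.mul_left_cancel ?_
    have h3 := congrArg (GLHat.evalOne p B n) (congrFun (congrFun (hC i) j) k)
    have h4 : ∀ M : Matrix (Fin n) (Fin n) B,
        GLHat.evalOne p B n (pullback p s M j k) = M j k := fun M =>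
      congrFun (congrFun (map_evalOne_pullback s M) j) k
    simp only [Matrix.add_apply, Matrix.smul_apply, smul_eq_mul, map_add, map_mul, h4,
      GLHat.evalOne_algebraMap, evalOne_metricPow, Matrix.map_apply] at h3
    simp only [Matrix.neg_apply, Matrix.map_apply]
    linear_combination -h3
  have h3 : (fun i => (L.torsion (algebraMap B (GLHat p B n) π) D.christoffel i).map
      (GLHat.evalOne p B n)) =
      L.torsion π fun i => (D.christoffel i).map (GLHat.evalOne p B n) := by
    refine funext fun i => Matrix.ext fun j k => ?_
    rw [Matrix.map_apply, L.torsion_apply, L.torsion_apply,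
      TorsionRing.map_subst p _ _ GLHat.evalOne_algebraMap]
    congr 2
    refine funext fun l => Matrix.ext fun a b => ?_
    simp only [Matrix.map_apply, Matrix.add_apply, Matrix.smul_apply, Matrix.transpose_apply,
      smul_eq_mul, map_add, map_mul, GLHat.evalOne_algebraMap, add_left_inj]
    rcases eq_or_ne a b with rfl | hab
    · rw [Matrix.one_apply_eq, Matrix.one_apply_eq, map_one]
    · rw [Matrix.one_apply_ne hab, Matrix.one_apply_ne hab, map_zero]
  rwa [h2, h3] at h1

omit [Fact p.Prime] in
theorem PiConnection.evalOne_christoffelFirst [IsAdicComplete (Ideal.span {(p : B)}) B]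
    {δ : Fin n → HigherPiDerivation p s π} (D : PiConnection δ n) (q : Matrix (Fin n) (Fin n) B)
    (i j k : Fin n) : GLHat.evalOne p B n (D.christoffelFirst q i j k) =
      ((D.christoffel i).map (GLHat.evalOne p B n) * q.map (· ^ p ^ s)) j k := by
  rw [christoffelFirst, map_sum, Matrix.mul_apply]
  refine Finset.sum_congr rfl fun m _ => ?_
  rw [map_mul, GLHat.evalOne_algebraMap, Matrix.map_apply, Matrix.map_apply]

theorem PiConnection.christoffelFirst_sub_mem [IsAdicComplete (Ideal.span {(p : B)}) B]
    (hp : p ≠ 2) (h : IsPseudoUniformizer p π)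
    {δ : Fin n → HigherPiDerivation p s π} {D : PiConnection δ n}
    {q : Matrix.GeneralLinearGroup (Fin n) B}
    (hq : (q : Matrix (Fin n) (Fin n) B).IsSymm) {L : TorsionSymbol p B n}
    (hD : D.IsMetric q) (hD' : D.IsSymmetric L) (i j k : Fin n) :
    D.christoffelFirst q i j k -
      (-Ring.inverse 2 * algebraMap B (GLHat p B n)
          ((δ i).der (q j k) + (δ j).der (q i k) - (δ k).der (q i j)) +
        Ring.inverse 2 * algebraMap B (GLHat p B n)
          (TorsionRing.subst p (fun _ => 1) (L.first s q k i j) +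
            TorsionRing.subst p (fun _ => 1) (L.first s q i j k) -
            TorsionRing.subst p (fun _ => 1) (L.first s q j k i))) ∈
      Ideal.span {algebraMap B (GLHat p B n) π} ⊔ GLHat.idealP p B n := by
  rw [← pow_one (algebraMap B (GLHat p B n) π)]
  refine GLHat.mem_sup_idealP_of_dvd h ?_
  have h2 := isUnit_two hp B
  have h3 : 2 * GLHat.evalOne p B n (Ring.inverse 2) = 1 := by
    have h4 := congrArg (GLHat.evalOne p B n)
      (Ring.mul_inverse_cancel _ (isUnit_two hp (GLHat p B n)))
    rwa [map_mul, map_ofNat, map_one] at h4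
  have key := (PiConnection.solvesEquations_evalOne h hq hD hD').dvd_sub_koszul h2 (hq.map _)
    (isUnit_det_map_pow q) (fun i => hq.map _) (fun i => (hq.map _).neg)
    (L.torsion_add_swap _ _) (t' := L.torsion π 0)
    (fun i j k => by simpa using L.dvd_torsion_sub h _ 0 0 (by simp) i j k) i j k
  rw [koszul_apply, ← D.evalOne_christoffelFirst] at key
  simp only [L.torsion_zero_mul, Matrix.neg_apply, Matrix.map_apply] at key
  rw [pow_one, ← h2.dvd_mul_left]
  convert key using 1
  simp only [map_sub, map_add, map_mul, map_neg, GLHat.evalOne_algebraMap]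
  linear_combination ((δ i).der (q j k) + (δ j).der (q i k) - (δ k).der (q i j) -
    (TorsionRing.subst p (fun _ => 1) (L.first s q k i j) +
      TorsionRing.subst p (fun _ => 1) (L.first s q i j k) -
      TorsionRing.subst p (fun _ => 1) (L.first s q j k i))) * h3

theorem PiConnection.christoffelFirst_mem [IsAdicComplete (Ideal.span {(p : B)}) B]
    (hp : p ≠ 2) (h : IsPseudoUniformizer p π)
    {δ : Fin n → HigherPiDerivation p s π} {D : PiConnection δ n}
    {q : Matrix.GeneralLinearGroup (Fin n) B}
    (hq : (q : Matrix (Fin n) (Fin n) B).IsSymm) {L : TorsionSymbol p B n}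
    (hD : D.IsMetric q) (hD' : D.IsSymmetric L) {m : ℕ}
    (hL : ∀ i j k, π ^ m ∣ TorsionRing.subst p (fun _ => (1 : Matrix (Fin n) (Fin n) B))
      (L.symb k i j))
    (hδ : ∀ i j k, π ^ m ∣ (δ i).der (q j k)) (i j k : Fin n) :
    D.christoffelFirst q i j k ∈
      Ideal.span {algebraMap B (GLHat p B n) π ^ m} ⊔ GLHat.idealP p B n := by
  refine GLHat.mem_sup_idealP_of_dvd h ?_
  rw [D.evalOne_christoffelFirst]
  refine (PiConnection.solvesEquations_evalOne h hq hD hD').pow_dvd (isUnit_two hp B) (hq.map _)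
    (isUnit_det_map_pow q) (fun i => hq.map _) (fun i => (hq.map _).neg)
    (L.torsion_add_swap _ _) (t' := L.torsion π 0)
    (fun r hr => L.dvd_torsion_sub h _ 0 r (by simpa using hr)) (fun i j k => ?_)
    (fun i j k => (dvd_neg).2 (hδ i j k)) i j k
  simpa [L.torsion_apply] using hL i j k

end LeviCivitaConnection

end LeviCivita
end

theorem theorem3 (p : ℕ) [Fact p.Prime] (hp : p ≠ 2) (π : LeviCivita.PrimeElements p)
    (n s : ℕ) (hs : 1 ≤ s)
    (δ : Fin n → LeviCivita.HigherPiDerivation p s (LeviCivita.RPi.unif p π))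
    (q : Matrix.GeneralLinearGroup (Fin n) (LeviCivita.RPi p π))
    (hq : (q : Matrix (Fin n) (Fin n) (LeviCivita.RPi p π)).IsSymm)
    (L : LeviCivita.TorsionSymbol p (LeviCivita.RPi p π) n) :
    (∃! D : LeviCivita.PiConnection δ n, D.IsMetric q ∧ D.IsSymmetric L) ∧
    ∀ D : LeviCivita.PiConnection δ n, D.IsMetric q → D.IsSymmetric L →
      (∀ i j k : Fin n,
        D.christoffelFirst q i j k -
          (-Ring.inverse 2 *
              algebraMap (LeviCivita.RPi p π) (LeviCivita.GLHat p (LeviCivita.RPi p π) n)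
                ((δ i).der (q j k) + (δ j).der (q i k) - (δ k).der (q i j)) +
            Ring.inverse 2 *
              algebraMap (LeviCivita.RPi p π) (LeviCivita.GLHat p (LeviCivita.RPi p π) n)
                (LeviCivita.TorsionRing.subst p (fun _ => 1) (L.first s q k i j) +
                  LeviCivita.TorsionRing.subst p (fun _ => 1) (L.first s q i j k) -
                  LeviCivita.TorsionRing.subst p (fun _ => 1) (L.first s q j k i))) ∈
        Ideal.span {algebraMap (LeviCivita.RPi p π) (LeviCivita.GLHat p (LeviCivita.RPi p π) n)
          (LeviCivita.RPi.unif p π)} ⊔ LeviCivita.GLHat.idealP p (LeviCivita.RPi p π) n) ∧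
      (∀ m : ℕ, 1 ≤ m →
        (∀ i j k : Fin n,
          LeviCivita.TorsionRing.subst p (fun _ => (1 : Matrix (Fin n) (Fin n)
              (LeviCivita.RPi p π))) (L.symb k i j) ∈
            Ideal.span {LeviCivita.RPi.unif p π ^ m} ∧
          (δ i).der (q j k) ∈ Ideal.span {LeviCivita.RPi.unif p π ^ m}) →
        ∀ i j k : Fin n,
          D.christoffelFirst q i j k ∈
            Ideal.span {algebraMap (LeviCivita.RPi p π)
              (LeviCivita.GLHat p (LeviCivita.RPi p π) n) (LeviCivita.RPi.unif p π) ^ m} ⊔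
            LeviCivita.GLHat.idealP p (LeviCivita.RPi p π) n) := by
  rcases Nat.eq_zero_or_pos n with rfl | hn
  · -- without any `δ_i` there is exactly one `π`-connection, and nothing to check
    refine ⟨⟨⟨fun i => i.elim0, fun i => i.elim0⟩, ⟨fun i => i.elim0, fun i => i.elim0⟩,
      fun D _ => LeviCivita.PiConnection.ext (funext fun i => i.elim0)⟩, fun D _ _ =>
      ⟨fun i => i.elim0, fun m _ _ i => i.elim0⟩⟩
  have h := LeviCivita.RPi.isPseudoUniformizer p π hs (δ ⟨0, hn⟩)
  refine ⟨LeviCivita.existsUnique_isMetric_isSymmetric hp h δ q hq L, fun D hD hD' =>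
    ⟨LeviCivita.PiConnection.christoffelFirst_sub_mem hp h hq hD hD', fun m _ hm =>
      LeviCivita.PiConnection.christoffelFirst_mem hp h hq hD hD'
        (fun i j k => Ideal.mem_span_singleton.1 (hm i j k).1)
        (fun i j k => Ideal.mem_span_singleton.1 (hm i j k).2)⟩⟩
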